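/- **Setting.** Let $\Sigma$ be a connected Riemann surface (compactness is not needed) with finitely many distinct marked points $b_i$ (the boundary points). Let $x$ be a (possibly multivalued) function on $\Sigma\setminus\{b_i\}$ whose differential $dx$ is a meromorphic $1$-form on $\Sigma$ with poles exactly at the $b_i$ and with finitely many zeros $z^1,\dots,z^N$ (the critical points), all simple; near each $z^\beta$ fix a branch of $x$. Let $y$ be a function that is defined and holomorphic near each $z^\beta$, with $dy(z^\beta)\neq 0$. Near $z^\beta$ let $z\mapsto\bar z$ be the nontrivial local holomorphic involution with $x(\bar z)=x(z)$ that fixes $z^\beta$. Let $B$ be a Bergman kernel on $\Sigma$: a symmetric bidifferential on $\Sigma\times\Sigma$, holomorphic off the diagonal and equal to $\frac{dw\,dw'}{(w-w')^2}+\text{holomorphic}$ in a local coordinate near each diagonal point. (No normalization of the periods of $B$ is required; for compact $\Sigma$ with a symplectic basis of the first homology, the Bergman kernel normalized to have zero $\mathcal A$-periods is such a $B$.) Put $\omega_{0,1}=y\,dx$, $\omega_{0,2}=B$, $\omega_{-1,n}=0$, and define recursively, for $g,n\ge 0$ with $2g-2+n+1>0$, $$\omega_{g,n+1}(z_0,z_{[n]})=\sum_{\beta=1}^{N}\operatorname*{Res}_{z=z^\beta}K_\beta(z_0,z)\,\mathcal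 R_{g,n}(z,\bar z,z_{[n]}),\qquad K_\beta(z_0,z)=\frac{\int_{z'=\bar z}^{z}B(z_0,z')}{2\,(y(z)-y(\bar z))\,dx(z)},$$ $$\mathcal R_{g,n}(z,\bar z,z_{[n]})=\omega_{g-1,n+2}(z,\bar z,z_{[n]})+\sum^{\prime}_{\substack{g_1+g_2=g\\ I\sqcup J=[n]}}\omega_{g_1,|I|+1}(z,z_I)\,\omega_{g_2,|J|+1}(\bar z,z_J),$$ where $[n]=\{1,\dots,n\}$, $z_I=(z_i)_{i\in I}$, the integral is taken along a path near $z^\beta$, and $\sum'$ omits all terms containing a factor $\omega_{0,1}$. **Statement.** Let $g,n\ge 0$ with $2g-2+n+1>0$, let $m\ge -1$ be an integer, and let $z_1,\dots,z_n\in\Sigma$ be points that are not critical points. Then for every $\gamma=1,\dots,N$ the two differentials whose residues are taken below are meromorphic at $z^\gamma$ and $$\operatorname*{Res}_{z_0=z^\gamma}x(z_0)^{m+1}\,y(z_0)\,\omega_{g,n+1}(z_0,z_{[n]})=\frac12\operatorname*{Res}_{z=z^\gamma}\frac{x(z)^{m+1}}{dx(z)}\,\mathcal R_{g,n}(z,\bar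 z,z_{[n]}).$$ Consequently (the ancestor Virasoro constraints for TR-differentials), $$\sum_{\gamma=1}^{N}\operatorname*{Res}_{z_0=z^\gamma}x(z_0)^{m+1}\,y(z_0)\,\omega_{g,n+1}(z_0,z_{[n]})=\frac12\sum_{\gamma=1}^{N}\operatorname*{Res}_{z=z^\gamma}\frac{x(z)^{m+1}}{dx(z)}\,\mathcal R_{g,n}(z,\bar z,z_{[n]}).$$ -/

import Mathlib

open Filter Topology Complex
open scoped Manifold ContDiff

namespace TR

noncomputable section

/-! ### One complex variable: residues and local involutions -/

/-- The residue at `c` of `f(w) dw`: the limit, as `r → 0⁺`, of `(2πi)⁻¹ ∮_{|w - c| = r} f(w) dw`.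
For `f` holomorphic on a punctured neighbourhood of `c` (in particular for `f` meromorphic at `c`)
the integral does not depend on small `r`. -/
def residue (f : ℂ → ℂ) (c : ℂ) : ℂ :=
  limUnder (𝓝[>] (0 : ℝ)) fun r : ℝ => (2 * (Real.pi : ℂ) * I)⁻¹ * ∮ w in C(c, r), f w

/-- `σ` is (the germ at `c` of) the nontrivial holomorphic involution fixing `c` and preserving
`f`. -/
structure IsLocalInvolution (f : ℂ → ℂ) (c : ℂ) (σ : ℂ → ℂ) : Prop where
  analyticAt : AnalyticAt ℂ σ c
  map_center : σ c = c
  comp_eq : ∀ᶠ w in 𝓝 c, f (σ w) = f w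
  ne_self : ∀ᶠ w in 𝓝[≠] c, σ w ≠ w
  involutive : ∀ᶠ w in 𝓝 c, σ (σ w) = w

/-- Near a simple critical point a holomorphic function has a local involution. -/
theorem exists_isLocalInvolution {f : ℂ → ℂ} {c : ℂ} (hf : AnalyticAt ℂ f c)
    (h1 : deriv f c = 0) (h2 : deriv (deriv f) c ≠ 0) : ∃ σ, IsLocalInvolution f c σ := by
  have hord : analyticOrderAt (f · - f c) c = (2 : ℕ) := by
    rw [← hf.analyticOrderAt_deriv_add_one,
      hf.deriv.analyticOrderAt_eq_one_of_zero_deriv_ne_zero h1 h2]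
    rfl
  obtain ⟨g, hg, hgc, hfg⟩ := (AnalyticAt.analyticOrderAt_eq_natCast (by fun_prop)).1 hord
  -- a local holomorphic square root `η` of `f - f c`
  obtain ⟨s, hs⟩ : ∃ s : ℂ, s ^ 2 = g c := IsAlgClosed.exists_pow_nat_eq _ (by norm_num)
  have hs0 : s ≠ 0 := by
    rintro rfl
    exact hgc (by rw [← hs]; norm_num)
  let h : ℂ → ℂ := fun w => s * Complex.exp (Complex.log (g w / g c) / 2)
  have hh : AnalyticAt ℂ h c := by
    have : AnalyticAt ℂ (fun w => Complex.log (g w / g c)) c :=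
      (hg.div_const).clog (by simp [hgc])
    exact analyticAt_const.mul ((this.div_const).cexp)
  have hhc : h c = s := by simp [h, hgc]
  have hhsq : ∀ᶠ w in 𝓝 c, h w ^ 2 = g w := by
    filter_upwards [hg.continuousAt.eventually_ne hgc] with w hw
    have : Complex.exp (Complex.log (g w / g c) / 2) ^ 2 = g w / g c := by
      rw [← Complex.exp_nat_mul]
      have : ((2 : ℕ) : ℂ) * (Complex.log (g w / g c) / 2) = Complex.log (g w / g c) := by
        push_cast; ring
      rw [this, Complex.exp_log (div_ne_zero hw hgc)]
    simp only [h, mul_pow, this, hs]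
    field_simp
  let η : ℂ → ℂ := fun w => (w - c) * h w
  have hη : AnalyticAt ℂ η c := by
    have : AnalyticAt ℂ (fun w : ℂ => w - c) c := by fun_prop
    exact this.mul hh
  have hηc : η c = 0 := by simp [η]
  have hη' : deriv η c = s := by
    have hd : HasDerivAt η (1 * h c + (c - c) * deriv h c) c :=
      ((hasDerivAt_id c).sub_const c).mul hh.differentiableAt.hasDerivAt
    rw [hd.deriv, hhc]; ring
  have hη'0 : deriv η c ≠ 0 := by rw [hη']; exact hs0
  have hfη : ∀ᶠ w in 𝓝 c, f w = f c + η w ^ 2 := by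
    filter_upwards [hfg, hhsq] with w hw1 hw2
    have : f w - f c = (w - c) ^ 2 * g w := by simpa using hw1
    simp only [η, mul_pow, hw2]
    linear_combination this
  -- its local inverse `ρ`
  let ρ : ℂ → ℂ := hη.hasStrictDerivAt.localInverse _ _ _ hη'0
  have hρ : AnalyticAt ℂ ρ 0 := by
    have := hη.analyticAt_localInverse hη'0
    rwa [hηc] at this
  have hρ0 : ρ 0 = c := by
    have : ρ (η c) = c := HasStrictFDerivAt.localInverse_apply_image ..
    rwa [hηc] at this
  have hl : ∀ᶠ w in 𝓝 c, ρ (η w) = w :=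
    HasStrictFDerivAt.eventually_left_inverse
      (hη.hasStrictDerivAt.hasStrictFDerivAt_equiv hη'0)
  have hr : ∀ᶠ t in 𝓝 (0 : ℂ), η (ρ t) = t := by
    have := HasStrictFDerivAt.eventually_right_inverse
      (hη.hasStrictDerivAt.hasStrictFDerivAt_equiv hη'0)
    rwa [hηc] at this
  have hηt : Tendsto η (𝓝 c) (𝓝 0) := by
    have := hη.continuousAt.tendsto
    rwa [hηc] at this
  have hnegt : Tendsto (fun w => -η w) (𝓝 c) (𝓝 0) := by simpa using hηt.neg
  let σ : ℂ → ℂ := fun w => ρ (-η w)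
  have hσ : AnalyticAt ℂ σ c := by
    have h0 : AnalyticAt ℂ ρ ((fun w => -η w) c) := by simpa [hηc] using hρ
    exact h0.comp (f := fun w => -η w) hη.neg
  have hσc : σ c = c := by simp [σ, hηc, hρ0]
  have hσt : Tendsto σ (𝓝 c) (𝓝 c) := by
    have := hσ.continuousAt.tendsto
    rwa [hσc] at this
  have hησ : ∀ᶠ w in 𝓝 c, η (σ w) = -η w := hnegt.eventually hr
  refine ⟨σ, hσ, hσc, ?_, ?_, ?_⟩
  · filter_upwards [hησ, hfη, hσt.eventually hfη] with w a1 a2 a3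
    rw [a3, a2, a1]; ring
  · have hne : ∀ᶠ w in 𝓝[≠] c, η w ≠ 0 := by
      have h' : ∀ᶠ w in 𝓝[≠] c, h w ≠ 0 :=
        (hh.continuousAt.eventually_ne (by rw [hhc]; exact hs0)).filter_mono nhdsWithin_le_nhds
      filter_upwards [h', self_mem_nhdsWithin] with w a1 a2
      exact mul_ne_zero (sub_ne_zero.2 a2) a1
    filter_upwards [hne, hησ.filter_mono nhdsWithin_le_nhds] with w a1 a2 a3
    rw [a3] at a2
    exact a1 (by linear_combination a2 / 2)
  · filter_upwards [hησ, hl] with w a1 a2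
    change ρ (-η (σ w)) = w
    rw [a1, neg_neg, a2]

open Classical in
/-- The local involution of `f` at a simple critical point `c` (only its germ at `c` matters). -/
def localInvolution (f : ℂ → ℂ) (c : ℂ) : ℂ → ℂ :=
  if h : ∃ σ, IsLocalInvolution f c σ then h.choose else id

theorem localInvolution_spec {f : ℂ → ℂ} {c : ℂ} (hf : AnalyticAt ℂ f c)
    (h1 : deriv f c = 0) (h2 : deriv (deriv f) c ≠ 0) :
    IsLocalInvolution f c (localInvolution f c) := by
  have h := exists_isLocalInvolution hf h1 h2
  rw [localInvolution, dif_pos h]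
  exact h.choose_spec

/-! ### Differentials on a Riemann surface -/

section Surface

variable {S : Type*} [TopologicalSpace S] [ChartedSpace ℂ S]

/-- The coordinate tangent vector `∂/∂w` at the point with coordinate `w`, in the preferred chart
centred at `p`. -/
def coordVec (p : S) (w : ℂ) : TangentBundle 𝓘(ℂ) S :=
  ⟨(chartAt ℂ p).symm w, mfderiv 𝓘(ℂ) 𝓘(ℂ) (chartAt ℂ p).symm w (1 : ℂ)⟩

/-- The coefficient `a` of a differential `α = a(w) dw` in the preferred chart at `p`. -/
def coeff (α : ∀ p : S, TangentSpace 𝓘(ℂ) p →L[ℂ] ℂ) (p : S) (w : ℂ) : ℂ :=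
  α (coordVec p w).proj (coordVec p w).snd

/-- The coefficient `b` of a bidifferential `B = b(w, w') dw dw'` in the preferred charts at `p`
and `q`. -/
def bicoeff (B : ∀ p q : S, TangentSpace 𝓘(ℂ) p →L[ℂ] TangentSpace 𝓘(ℂ) q →L[ℂ] ℂ)
    (p q : S) (w : ℂ × ℂ) : ℂ :=
  B (coordVec p w.1).proj (coordVec q w.2).proj (coordVec p w.1).snd (coordVec q w.2).snd

/-- A symmetric bidifferential on `S × S`, holomorphic away from the diagonal, and equal to
`dw dw' / (w - w')² + holomorphic` near each point of the diagonal. On a compact surface, the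
Bergman kernel attached to any choice of symplectic basis of the first homology is the one with
vanishing `A`-periods. -/
structure IsFundamentalBidifferential
    (B : ∀ p q : S, TangentSpace 𝓘(ℂ) p →L[ℂ] TangentSpace 𝓘(ℂ) q →L[ℂ] ℂ) : Prop where
  symm : ∀ p q, p ≠ q → ∀ u v, B p q u v = B q p v u
  analyticAt : ∀ p q, p ≠ q → AnalyticAt ℂ (bicoeff B p q) (chartAt ℂ p p, chartAt ℂ q q)
  diagonal : ∀ p, ∃ h : ℂ × ℂ → ℂ, AnalyticAt ℂ h (chartAt ℂ p p, chartAt ℂ p p) ∧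
    ∀ᶠ w in 𝓝 (chartAt ℂ p p, chartAt ℂ p p), w.1 ≠ w.2 →
      bicoeff B p p w = 1 / (w.1 - w.2) ^ 2 + h w

variable (S) in
/-- A spectral curve `(S, x, y)` with its Bergman kernel. The function `x` may be multivalued; its
differential `dx` is globally defined, and `x : S → ℂ` stands for a choice of branch near each
critical point. Likewise `y : S → ℂ` is only meaningful near the critical points. -/
structure SpectralCurve where
  /-- number of boundary points -/
  M : ℕ
  /-- number of critical points -/
  N : ℕ
  boundary : Fin M → S
  crit : Fin N → S
  dx : ∀ p : S, TangentSpace 𝓘(ℂ) p →L[ℂ] ℂ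
  x : S → ℂ
  y : S → ℂ
  B : ∀ p q : S, TangentSpace 𝓘(ℂ) p →L[ℂ] TangentSpace 𝓘(ℂ) q →L[ℂ] ℂ
  boundary_injective : Function.Injective boundary
  crit_injective : Function.Injective crit
  /-- `dx` is holomorphic away from the boundary points … -/
  dx_analyticAt : ∀ p ∉ Set.range boundary, AnalyticAt ℂ (coeff dx p) (chartAt ℂ p p)
  /-- … at which it has poles; -/
  dx_meromorphicAt : ∀ i,
    MeromorphicAt (coeff dx (boundary i)) (chartAt ℂ (boundary i) (boundary i))
  dx_pole : ∀ i,
    meromorphicOrderAt (coeff dx (boundary i)) (chartAt ℂ (boundary i) (boundary i)) < 0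
  /-- its zeros are exactly the critical points, … -/
  dx_eq_zero_iff : ∀ p ∉ Set.range boundary, dx p = 0 ↔ p ∈ Set.range crit
  crit_notMem_boundary : ∀ β, crit β ∉ Set.range boundary
  /-- … and they are simple. -/
  dx_simple : ∀ β, deriv (coeff dx (crit β)) (chartAt ℂ (crit β) (crit β)) ≠ 0
  hasMFDerivAt_x : ∀ β, ∀ᶠ p in 𝓝 (crit β), HasMFDerivAt 𝓘(ℂ) 𝓘(ℂ) x p (dx p)
  mdifferentiableAt_y : ∀ β, ∀ᶠ p in 𝓝 (crit β), MDifferentiableAt 𝓘(ℂ) 𝓘(ℂ) y p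
  dy_ne_zero : ∀ β, mfderiv 𝓘(ℂ) 𝓘(ℂ) y (crit β) ≠ 0
  isFundamentalBidifferential_B : IsFundamentalBidifferential B

namespace SpectralCurve

variable (C : SpectralCurve S)

/-- The coordinate of the critical point `z^β` in the preferred chart there. -/
def center (β : Fin C.N) : ℂ := chartAt ℂ (C.crit β) (C.crit β)

/-- The tangent vector `∂/∂w` at the point `z` with coordinate `w` near `z^β`. -/
def vec (β : Fin C.N) (w : ℂ) : TangentBundle 𝓘(ℂ) S := coordVec (C.crit β) w

/-- The local involution `z ↦ z̄` near `z^β`, in the preferred coordinate. -/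
def conj (β : Fin C.N) : ℂ → ℂ :=
  localInvolution (fun w => C.x ((chartAt ℂ (C.crit β)).symm w)) (C.center β)

theorem isLocalInvolution_conj [IsManifold 𝓘(ℂ) ω S] (β : Fin C.N) :
    IsLocalInvolution (fun w => C.x ((chartAt ℂ (C.crit β)).symm w)) (C.center β)
      (C.conj β) := by
  have hmem : C.center β ∈ (chartAt ℂ (C.crit β)).target := mem_chart_target ℂ (C.crit β)
  have hsymm : (chartAt ℂ (C.crit β)).symm (C.center β) = C.crit β :=
    (chartAt ℂ (C.crit β)).left_inv (mem_chart_source ℂ (C.crit β))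
  have hcont : Tendsto (chartAt ℂ (C.crit β)).symm (𝓝 (C.center β)) (𝓝 (C.crit β)) := by
    have := ((chartAt ℂ (C.crit β)).continuousAt_symm hmem).tendsto
    rwa [hsymm] at this
  have hd : ∀ᶠ w in 𝓝 (C.center β),
      HasDerivAt (fun w => C.x ((chartAt ℂ (C.crit β)).symm w)) (coeff C.dx (C.crit β) w) w := by
    filter_upwards [hcont.eventually (C.hasMFDerivAt_x β),
      (chartAt ℂ (C.crit β)).open_target.mem_nhds hmem] with w h1 h2
    have h3 : HasMFDerivAt 𝓘(ℂ) 𝓘(ℂ) (chartAt ℂ (C.crit β)).symm w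
        (mfderiv 𝓘(ℂ) 𝓘(ℂ) (chartAt ℂ (C.crit β)).symm w) :=
      (mdifferentiableAt_atlas_symm (chart_mem_atlas ℂ (C.crit β)) h2).hasMFDerivAt
    have h4 := (HasMFDerivAt.comp w h1 h3).hasFDerivAt
    let L : ℂ →L[ℂ] ℂ :=
      ContinuousLinearMap.comp (C.dx ((chartAt ℂ (C.crit β)).symm w))
        (mfderiv 𝓘(ℂ) 𝓘(ℂ) (chartAt ℂ (C.crit β)).symm w)
    have h5 : HasFDerivAt (fun w => C.x ((chartAt ℂ (C.crit β)).symm w)) L w := h4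
    exact h5.hasDerivAt
  have han : AnalyticAt ℂ (fun w => C.x ((chartAt ℂ (C.crit β)).symm w)) (C.center β) :=
    Complex.analyticAt_iff_eventually_differentiableAt.2 (hd.mono fun w h => h.differentiableAt)
  refine localInvolution_spec han ?_ ?_
  · have h0 : C.dx (C.crit β) = 0 :=
      (C.dx_eq_zero_iff _ (C.crit_notMem_boundary β)).2 ⟨β, rfl⟩
    rw [hd.self_of_nhds.deriv]
    have h0' : C.dx ((chartAt ℂ (C.crit β)).symm (C.center β)) = 0 := by rw [hsymm, h0]
    change C.dx ((chartAt ℂ (C.crit β)).symm (C.center β)) _ = 0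
    rw [h0']
    rfl
  · have : deriv (fun w => C.x ((chartAt ℂ (C.crit β)).symm w)) =ᶠ[𝓝 (C.center β)]
        coeff C.dx (C.crit β) := hd.mono fun w h => h.deriv
    rw [this.deriv_eq]
    exact C.dx_simple β

/-- The image at `z̄` of the tangent vector `∂/∂w` at `z` under the local involution. -/
def conjVec (β : Fin C.N) (w : ℂ) : TangentBundle 𝓘(ℂ) S :=
  ⟨(C.vec β (C.conj β w)).proj, deriv (C.conj β) w • (C.vec β (C.conj β w)).snd⟩

/-- The differential `dx` evaluated at a tangent vector. -/
def dxAt (v : TangentBundle 𝓘(ℂ) S) : ℂ := C.dx v.proj v.snd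

/-- The Bergman kernel evaluated at a pair of tangent vectors. -/
def bergman (u v : TangentBundle 𝓘(ℂ) S) : ℂ := C.B u.proj v.proj u.snd v.snd

/-- `∫_{z' = z̄}^{z} B(z₀, z')`, along the straight segment in the preferred coordinate
near `z^β`. -/
def bergmanIntegral (β : Fin C.N) (v₀ : TangentBundle 𝓘(ℂ) S) (w : ℂ) : ℂ :=
  ∫ t in (0 : ℝ)..1, (w - C.conj β w) *
    C.bergman v₀ (C.vec β (C.conj β w + (t : ℂ) * (w - C.conj β w)))

/-- The recursion kernel `K_β(z₀, z) = ∫_{z̄}^{z} B(z₀, ·) / (2 (y(z) - y(z̄)) dx(z))`, evaluated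
at a tangent vector at `z₀` and at `∂/∂w` at the point `z` with coordinate `w`. -/
def kernel (β : Fin C.N) (v₀ : TangentBundle 𝓘(ℂ) S) (w : ℂ) : ℂ :=
  C.bergmanIntegral β v₀ w /
    (2 * (C.y (C.vec β w).proj - C.y (C.conjVec β w).proj) * C.dxAt (C.vec β w))

/-- `C.multidiff g n z₀ (z₁, …, zₙ)` is the multidifferential `ω_{g,n+1}(z₀, z₁, …, zₙ)` of the
topological recursion, evaluated at tangent vectors at the points `z₀, …, zₙ`.
The sum over `g₁ + g₂ = g` and `I ⊔ J = [n]` is the sum over `g₁ ≤ g` and over subsets `I` of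
`[n]`, with `g₂ = g - g₁` and `J = Iᶜ`, the terms with a factor `ω_{0,1}` being left out. -/
def multidiff (g n : ℕ) (v₀ : TangentBundle 𝓘(ℂ) S) (v : Fin n → TangentBundle 𝓘(ℂ) S) : ℂ :=
  if g = 0 ∧ n = 0 then C.y v₀.proj * C.dxAt v₀
  else if h : g = 0 ∧ n = 1 then C.bergman v₀ (v ⟨0, by omega⟩)
  else ∑ β : Fin C.N, residue (fun w => C.kernel β v₀ w *
    ((if g = 0 then 0
        else multidiff (g - 1) (n + 1) (C.vec β w) (Fin.cons (C.conjVec β w) v)) +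
      ∑ g₁ : Fin (g + 1), ∑ I : Finset (Fin n),
        if ((g₁ : ℕ) = 0 ∧ I.card = 0) ∨ (g - (g₁ : ℕ) = 0 ∧ Iᶜ.card = 0) then 0
        else multidiff g₁ I.card (C.vec β w) (fun i => v (I.orderEmbOfFin rfl i)) *
          multidiff (g - g₁) Iᶜ.card (C.conjVec β w) (fun i => v (Iᶜ.orderEmbOfFin rfl i))))
      (C.center β)
termination_by 2 * g + n
decreasing_by
  · omega
  all_goals
    have h₁ := g₁.isLt
    have h₂ : I.card + Iᶜ.card = n := by simp
    omega

/-- The bracket `ω_{g-1,n+2}(z, z̄, z_[n]) + Σ' ω_{g₁,|I|+1}(z, z_I) ω_{g₂,|J|+1}(z̄, z_J)`,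
where `ω_{-1,n+2} = 0`, at the tangent vector `∂/∂w` at `z`, its image at `z̄`, and tangent
vectors at `z₁, …, zₙ`. -/
def bracket (β : Fin C.N) (g n : ℕ) (w : ℂ) (v : Fin n → TangentBundle 𝓘(ℂ) S) : ℂ :=
  (if g = 0 then 0
    else C.multidiff (g - 1) (n + 1) (C.vec β w) (Fin.cons (C.conjVec β w) v)) +
  ∑ g₁ : Fin (g + 1), ∑ I : Finset (Fin n),
    if ((g₁ : ℕ) = 0 ∧ I.card = 0) ∨ (g - (g₁ : ℕ) = 0 ∧ Iᶜ.card = 0) then 0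
    else C.multidiff g₁ I.card (C.vec β w) (fun i => v (I.orderEmbOfFin rfl i)) *
      C.multidiff (g - g₁) Iᶜ.card (C.conjVec β w) (fun i => v (Iᶜ.orderEmbOfFin rfl i))

theorem multidiff_zero_zero (v₀ : TangentBundle 𝓘(ℂ) S) (v : Fin 0 → TangentBundle 𝓘(ℂ) S) :
    C.multidiff 0 0 v₀ v = C.y v₀.proj * C.dxAt v₀ := by
  rw [multidiff]; simp

theorem multidiff_zero_one (v₀ : TangentBundle 𝓘(ℂ) S) (v : Fin 1 → TangentBundle 𝓘(ℂ) S) :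
    C.multidiff 0 1 v₀ v = C.bergman v₀ (v 0) := by
  rw [multidiff]; simp

/-- The topological recursion. -/
theorem multidiff_stable {g n : ℕ} (h : 1 < 2 * g + n) (v₀ : TangentBundle 𝓘(ℂ) S)
    (v : Fin n → TangentBundle 𝓘(ℂ) S) :
    C.multidiff g n v₀ v =
      ∑ β, residue (fun w => C.kernel β v₀ w * C.bracket β g n w v) (C.center β) := by
  rw [multidiff, if_neg (by omega), dif_neg (by omega)]
  rfl

/-- The integrand `x(z₀)^{m+1} y(z₀) ω_{g,n+1}(z₀, z_[n])` in the preferred coordinate at `z^γ`. -/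
def lhsIntegrand (γ : Fin C.N) (m : ℤ) (g n : ℕ) (v : Fin n → TangentBundle 𝓘(ℂ) S) (w : ℂ) : ℂ :=
  C.x (C.vec γ w).proj ^ (m + 1) * C.y (C.vec γ w).proj * C.multidiff g n (C.vec γ w) v

/-- The integrand `x(z)^{m+1} / dx(z) · (ω_{g-1,n+2}(z, z̄, z_[n]) + Σ' …)` in the preferred
coordinate at `z^γ`. -/
def rhsIntegrand (γ : Fin C.N) (m : ℤ) (g n : ℕ) (v : Fin n → TangentBundle 𝓘(ℂ) S) (w : ℂ) : ℂ :=
  C.x (C.vec γ w).proj ^ (m + 1) / C.dxAt (C.vec γ w) * C.bracket γ g n w v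

end SpectralCurve

end Surface

end

end TR

namespace TR

noncomputable section

/-! ### Taylor coefficients and residues of meromorphic germs -/

/-! The point `z₀` enters the recursion only through `∫ B(z₀, ·)`. Let `F` be a local primitive of
`B(z₀, ·)` at `z^β`, let `σ` be the involution, and let `G_β` be the bracket divided by `2 (y(z) -
y(z̄)) dx(z)`. The `β`-term of the recursion is then `Res G_β (F - F ∘ σ)`. If `G_β` is meromorphic,
the functional `φ ↦ Res G_β (φ - φ ∘ σ)` on holomorphic germs is a finite combination `∑ ℓ_{β,k}
φ_{k+1}` of Taylor coefficients (`exists_residue_mul_sub_comp_eq_sum`). Hence `ω_{g,n+1}` is, as a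
differential in `z₀`, the sum of the `ℓ_{β,k} / (k + 1)` times the `k`-th Taylor coefficients of
`B(z₀, ·)` at `z^β`.

Near `z^γ` such a coefficient is `(k + 1) / (z₀ - z^γ)^(k+2)` plus a holomorphic function if `β =
γ`, and holomorphic otherwise. So its residue against a holomorphic `f` is `(k + 1) f_{k+1}` or `0`
(`hasResidue_mul_bergmanCoeff_vec`). Therefore `Res f ω_{g,n+1} = ∑ ℓ_{γ,k} f_{k+1} = Res G_γ (f - f
∘ σ)`: the two residues are exchanged by comparing finite sums. For `f = x^(m+1) y`, invariance of
`x` gives `f - f ∘ σ = x^(m+1) (y(z) - y(z̄))`. The `y`-difference cancels against the kernel and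
leaves `1/2 x^(m+1) / dx` times the bracket.

What remains is meromorphy of the bracket, which puts moving points into several arguments of one
multidifferential at once. Meromorphy in each variable separately would not be enough. Instead,
every stable `ω_{g,n+1}` is shown, by induction on `2g + n`, to be a polynomial in the Taylor
coefficients of `B` at the critical points (`isBergmanPoly_multidiff`). Substituting moving points
into such a polynomial gives meromorphic functions. The induction closes because taking the residue
of an expansion whose coefficients are such polynomials gives such a polynomial again
(`HasLaurentExpansion.residue`). -/

/-- The `k`-th Taylor coefficient of `f` at `c`. -/
def taylorCoeff (f : ℂ → ℂ) (c : ℂ) (k : ℕ) : ℂ := iteratedDeriv k f c / k.factorial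

theorem taylorCoeff_congr {f g : ℂ → ℂ} {c : ℂ} (h : f =ᶠ[𝓝 c] g) (k : ℕ) :
    taylorCoeff f c k = taylorCoeff g c k := by
  rw [taylorCoeff, taylorCoeff, h.iteratedDeriv_eq]

theorem taylorCoeff_add {f g : ℂ → ℂ} {c : ℂ} (hf : AnalyticAt ℂ f c) (hg : AnalyticAt ℂ g c)
    (k : ℕ) : taylorCoeff (fun w => f w + g w) c k = taylorCoeff f c k + taylorCoeff g c k := by
  rw [taylorCoeff, taylorCoeff, taylorCoeff, iteratedDeriv_fun_add hf.contDiffAt hg.contDiffAt,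
    add_div]

/-- The identity holds at every `w`, not only near `c`, so it can be evaluated at `σ w` without any
smallness condition. -/
theorem exists_taylor_remainder {f : ℂ → ℂ} {c : ℂ} (hf : AnalyticAt ℂ f c) (K : ℕ) :
    ∃ ψ : ℂ → ℂ, AnalyticAt ℂ ψ c ∧
      ∀ w, f w = ∑ k ∈ Finset.range K, taylorCoeff f c k * (w - c) ^ k + (w - c) ^ K * ψ w := by
  have h0 : AnalyticAt ℂ (fun z => f (z + c)) 0 := by
    have : AnalyticAt ℂ f ((fun z : ℂ => z + c) 0) := by simpa using hf
    exact this.comp (f := fun z : ℂ => z + c) (by fun_prop)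
  obtain ⟨F, hF, h⟩ := h0.exists_eq_sum_add_pow_mul K
  refine ⟨fun w => F (w - c), ?_, fun w => ?_⟩
  · have : AnalyticAt ℂ F ((fun w : ℂ => w - c) c) := by simpa using hF
    exact this.comp (f := fun w : ℂ => w - c) (by fun_prop)
  · have := h (w - c)
    simp only [sub_add_cancel, smul_eq_mul] at this
    rw [this]
    congr 1
    refine Finset.sum_congr rfl fun k _ => ?_
    rw [taylorCoeff, iteratedDeriv_comp_add_const]
    simp only [zero_add]
    ring

/-- The circle integrals around `c` that define the residue of `f` are eventually equal to `a`. -/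
def HasResidue (f : ℂ → ℂ) (c a : ℂ) : Prop :=
  ∀ᶠ r in 𝓝[>] (0 : ℝ), CircleIntegrable f c r ∧ (2 * (Real.pi : ℂ) * I)⁻¹ * (∮ w in C(c, r), f w) = a

/-- Circles of positive radius avoid their centre, so residues depend only on the punctured germ. -/
theorem eventually_forall_sphere {c : ℂ} {p : ℂ → Prop} (h : ∀ᶠ w in 𝓝[≠] c, p w) :
    ∀ᶠ r in 𝓝[>] (0 : ℝ), 0 < r ∧ ∀ w ∈ Metric.sphere c r, p w := by
  rw [eventually_nhdsWithin_iff, Metric.eventually_nhds_iff] at h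
  obtain ⟨ε, hε, h⟩ := h
  filter_upwards [Ioo_mem_nhdsGT hε] with r hr
  refine ⟨hr.1, fun w hw => h ?_ ?_⟩
  · rw [Metric.mem_sphere.1 hw]; exact hr.2
  · rintro rfl
    simp only [Metric.mem_sphere, dist_self] at hw
    exact hr.1.ne hw

namespace HasResidue

variable {f g : ℂ → ℂ} {a b c : ℂ}

theorem residue_eq (h : HasResidue f c a) : residue f c = a :=
  Tendsto.limUnder_eq ((tendsto_congr' (h.mono fun _ h => h.2)).2 tendsto_const_nhds)

theorem congr (h : HasResidue f c a) (hfg : f =ᶠ[𝓝[≠] c] g) : HasResidue g c a := by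
  filter_upwards [h, eventually_forall_sphere hfg] with r ⟨h1, h2⟩ ⟨hr, h3⟩
  refine ⟨(circleIntegrable_congr fun w hw => h3 w (by rwa [abs_of_pos hr] at hw)).1 h1, ?_⟩
  rw [← h2, circleIntegral.integral_congr hr.le h3]

theorem add (hf : HasResidue f c a) (hg : HasResidue g c b) :
    HasResidue (fun w => f w + g w) c (a + b) := by
  filter_upwards [hf, hg] with r ⟨h1, h2⟩ ⟨h3, h4⟩
  refine ⟨h1.add h3, ?_⟩
  rw [circleIntegral.integral_add h1 h3, mul_add, h2, h4]

theorem const_mul (hf : HasResidue f c a) (b : ℂ) : HasResidue (fun w => b * f w) c (b * a) := by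
  filter_upwards [hf] with r ⟨h1, h2⟩
  refine ⟨h1.const_smul (a := b), ?_⟩
  rw [circleIntegral.integral_const_mul, ← h2]
  ring

theorem zero (c : ℂ) : HasResidue (fun _ => 0) c 0 :=
  Eventually.of_forall fun r => ⟨circleIntegrable_const 0 c r, by simp [circleIntegral]⟩

theorem sum {ι : Type*} {s : Finset ι} {f : ι → ℂ → ℂ} {a : ι → ℂ}
    (h : ∀ i ∈ s, HasResidue (f i) c (a i)) :
    HasResidue (fun w => ∑ i ∈ s, f i w) c (∑ i ∈ s, a i) := by
  classical
  induction s using Finset.induction_on with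
  | empty => simpa using zero c
  | insert i s hi ih =>
    simp only [Finset.sum_insert hi]
    exact (h i (by simp)).add (ih fun j hj => h j (by simp [hj]))

theorem of_analyticAt (hf : AnalyticAt ℂ f c) : HasResidue f c 0 := by
  obtain ⟨ε, hε, h⟩ := Metric.eventually_nhds_iff.1 hf.eventually_analyticAt
  filter_upwards [Ioo_mem_nhdsGT hε] with r hr
  have hcont : ContinuousOn f (Metric.closedBall c r) := fun w hw =>
    (h ((Metric.mem_closedBall.1 hw).trans_lt hr.2)).continuousAt.continuousWithinAt
  refine ⟨(hcont.mono Metric.sphere_subset_closedBall).circleIntegrable hr.1.le, ?_⟩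
  rw [Complex.circleIntegral_eq_zero_of_differentiable_on_off_countable hr.1.le
    Set.countable_empty hcont, mul_zero]
  exact fun w hw => (h ((Metric.mem_ball.1 hw.1).trans hr.2)).differentiableAt

theorem zpow (c : ℂ) (n : ℤ) : HasResidue (fun w => (w - c) ^ n) c (if n = -1 then 1 else 0) := by
  filter_upwards [self_mem_nhdsWithin] with r (hr : 0 < r)
  refine ⟨circleIntegrable_sub_zpow_iff.2 (Or.inr (Or.inr ?_)), ?_⟩
  · simpa [abs_of_pos hr] using hr.ne
  · split_ifs with h
    · subst h
      simp only [zpow_neg_one]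
      rw [circleIntegral.integral_sub_center_inv c hr.ne',
        inv_mul_cancel₀ (by simp [Real.pi_ne_zero])]
    · rw [circleIntegral.integral_sub_zpow_of_ne h, mul_zero]

theorem taylor (hf : AnalyticAt ℂ f c) (k : ℕ) :
    HasResidue (fun w => f w / (w - c) ^ (k + 1)) c (taylorCoeff f c k) := by
  obtain ⟨ψ, hψ, h⟩ := exists_taylor_remainder hf (k + 1)
  have h1 : HasResidue (fun w => ∑ j ∈ Finset.range (k + 1),
      taylorCoeff f c j * (w - c) ^ ((j : ℤ) - (k + 1)) + ψ w) c
      (∑ j ∈ Finset.range (k + 1), taylorCoeff f c j *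
        (if (j : ℤ) - (k + 1) = -1 then 1 else 0) + 0) :=
    (sum fun j _ => (zpow c _).const_mul _).add (of_analyticAt hψ)
  have h2 : (∑ j ∈ Finset.range (k + 1), taylorCoeff f c j *
        (if (j : ℤ) - (k + 1) = -1 then 1 else 0) + 0) = taylorCoeff f c k := by
    rw [add_zero, Finset.sum_eq_single k]
    · simp
    · intro j _ hj
      rw [if_neg (by omega), mul_zero]
    · simp
  rw [h2] at h1
  refine h1.congr ?_
  filter_upwards [self_mem_nhdsWithin] with w hw
  have hw' : w - c ≠ 0 := sub_ne_zero.2 hw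
  rw [h w, add_div, Finset.sum_div, mul_div_cancel_left₀ _ (pow_ne_zero _ hw')]
  congr 1
  refine Finset.sum_congr rfl fun j _ => ?_
  rw [zpow_sub₀ hw', mul_div_assoc]
  norm_cast

end HasResidue

theorem hasResidue_of_meromorphicAt {f : ℂ → ℂ} {c : ℂ} (hf : MeromorphicAt f c) :
    HasResidue f c (residue f c) := by
  obtain ⟨P, hP⟩ := hf
  -- The extra factor `w - c` turns the exponent `P`, which may be `0`, into the `P + 1` required by
  -- `HasResidue.taylor`.
  have hP' : AnalyticAt ℂ (fun w => (w - c) * ((w - c) ^ P • f w)) c :=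
    AnalyticAt.mul (by fun_prop) hP
  have h := (HasResidue.taylor hP' P).congr (g := f) (by
    filter_upwards [self_mem_nhdsWithin] with w hw
    have hw' : w - c ≠ 0 := sub_ne_zero.2 hw
    simp only [smul_eq_mul]
    field_simp
    ring)
  rwa [h.residue_eq]

/-! ### Primitives and parameter dependence -/

/-- A holomorphic function on a disc is exact, and the disc is convex, so the segment between any
two of its points can be used. Both endpoints are left free so that `w` and `σ w` can be inserted.
The normalization at `c` leaves no undetermined Taylor coefficient. -/
theorem exists_primitive {f : ℂ → ℂ} {c : ℂ} (hf : AnalyticAt ℂ f c) :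
    ∃ F : ℂ → ℂ, AnalyticAt ℂ F c ∧ taylorCoeff F c 0 = 0 ∧
      (∀ k, taylorCoeff F c (k + 1) = taylorCoeff f c k / (k + 1)) ∧
      ∀ᶠ p : ℂ × ℂ in 𝓝 (c, c),
        ∫ t in (0 : ℝ)..1, (p.1 - p.2) * f (p.2 + (t : ℂ) * (p.1 - p.2)) = F p.1 - F p.2 := by
  obtain ⟨ε, hε, h⟩ := Metric.eventually_nhds_iff.1 hf.eventually_analyticAt
  have hd : DifferentiableOn ℂ f (Metric.ball c ε) := fun w hw =>
    (h (Metric.mem_ball.1 hw)).differentiableAt.differentiableWithinAt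
  obtain ⟨F, hFc, hF⟩ := hd.isExactOn_ball.with_val_at c 0
  have hball : Metric.ball c ε ∈ 𝓝 c := Metric.ball_mem_nhds c hε
  have hFd : deriv F =ᶠ[𝓝 c] f := by
    filter_upwards [hball] with w hw using (hF w hw).deriv
  refine ⟨F, ?_, ?_, fun k => ?_, ?_⟩
  · refine Complex.analyticAt_iff_eventually_differentiableAt.2 ?_
    filter_upwards [hball] with w hw using (hF w hw).differentiableAt
  · simp [taylorCoeff, hFc]
  · rw [taylorCoeff, taylorCoeff, iteratedDeriv_succ', hFd.iteratedDeriv_eq, Nat.factorial_succ]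
    push_cast
    rw [div_div, mul_comm]
  · have : Metric.ball c ε ×ˢ Metric.ball c ε ∈ 𝓝 (c, c) := prod_mem_nhds hball hball
    filter_upwards [this] with p hp
    have hseg : ∀ t ∈ Set.uIcc (0 : ℝ) 1,
        p.2 + (t : ℂ) * (p.1 - p.2) ∈ Metric.ball c ε := by
      intro t ht
      rw [Set.uIcc_of_le zero_le_one] at ht
      have := (convex_ball c ε).add_smul_sub_mem hp.2 hp.1 ht
      simpa using this
    have hder : ∀ t ∈ Set.uIcc (0 : ℝ) 1,
        HasDerivAt (fun t : ℝ => F (p.2 + (t : ℂ) * (p.1 - p.2)))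
          ((p.1 - p.2) * f (p.2 + (t : ℂ) * (p.1 - p.2))) t := by
      intro t ht
      have h1 : HasDerivAt (fun z : ℂ => p.2 + z * (p.1 - p.2)) (p.1 - p.2) (t : ℂ) := by
        simpa using ((hasDerivAt_id (t : ℂ)).mul_const (p.1 - p.2)).const_add p.2
      have h2 := (HasDerivAt.comp (t : ℂ) (hF _ (hseg t ht)) h1).comp_ofReal
      rw [mul_comm]
      exact h2
    rw [intervalIntegral.integral_eq_sub_of_hasDerivAt hder]
    · simp
    · refine ContinuousOn.intervalIntegrable fun t ht => ?_
      have h1 : ContinuousAt (fun t : ℝ => p.2 + (t : ℂ) * (p.1 - p.2)) t := by fun_prop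
      have h2 : ContinuousAt f (p.2 + (t : ℂ) * (p.1 - p.2)) :=
        (h (Metric.mem_ball.1 (hseg t ht))).continuousAt
      exact (continuousAt_const.mul
        (ContinuousAt.comp (f := fun t : ℝ => p.2 + (t : ℂ) * (p.1 - p.2)) h2
          h1)).continuousWithinAt

/-- Each differentiation in the second variable is the Fréchet derivative in the direction `(0, 1)`,
which is again jointly analytic. -/
theorem exists_iteratedDeriv_snd {h : ℂ × ℂ → ℂ} {q : ℂ × ℂ} (hh : AnalyticAt ℂ h q) (k : ℕ) :
    ∃ H : ℂ × ℂ → ℂ, AnalyticAt ℂ H q ∧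
      ∀ᶠ p in 𝓝 q, iteratedDeriv k (fun z => h (p.1, z)) p.2 = H p := by
  induction k with
  | zero => exact ⟨h, hh, by simp⟩
  | succ k ih =>
    obtain ⟨H, hH, he⟩ := ih
    refine ⟨fun p => fderiv ℂ H p (0, 1), 
      (ContinuousLinearMap.analyticAt (ContinuousLinearMap.apply ℂ ℂ ((0 : ℂ), (1 : ℂ))) _).comp
        hH.fderiv, ?_⟩
    filter_upwards [he.eventually_nhds, hH.eventually_analyticAt] with p hp hHp
    have hc : Tendsto (fun z : ℂ => (p.1, z)) (𝓝 p.2) (𝓝 p) := by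
      have : ContinuousAt (fun z : ℂ => (p.1, z)) p.2 := by fun_prop
      exact this
    have h1 : iteratedDeriv k (fun z => h (p.1, z)) =ᶠ[𝓝 p.2] fun z => H (p.1, z) :=
      hc.eventually hp
    have h2 : HasDerivAt (fun z : ℂ => (p.1, z)) ((0 : ℂ), (1 : ℂ)) p.2 :=
      (hasDerivAt_const p.2 p.1).prodMk (hasDerivAt_id p.2)
    rw [iteratedDeriv_succ, h1.deriv_eq]
    have h3 : HasFDerivAt H (fderiv ℂ H p) (p.1, p.2) := hHp.differentiableAt.hasFDerivAt
    exact (h3.comp_hasDerivAt p.2 h2).deriv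

theorem exists_taylorCoeff_snd {h : ℂ × ℂ → ℂ} {a b : ℂ} (hh : AnalyticAt ℂ h (a, b)) (k : ℕ) :
    ∃ H : ℂ → ℂ, AnalyticAt ℂ H a ∧
      ∀ᶠ w in 𝓝 a, taylorCoeff (fun z => h (w, z)) b k = H w := by
  obtain ⟨H, hH, he⟩ := exists_iteratedDeriv_snd hh k
  have hc : AnalyticAt ℂ (fun w : ℂ => (w, b)) a := by fun_prop
  refine ⟨fun w => H (w, b) / k.factorial,
    (AnalyticAt.comp (f := fun w : ℂ => (w, b)) hH hc).div_const, ?_⟩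
  have : Tendsto (fun w : ℂ => (w, b)) (𝓝 a) (𝓝 (a, b)) := hc.continuousAt
  filter_upwards [this.eventually he] with w hw
  rw [taylorCoeff, hw]

theorem iteratedDeriv_one_div_sub_sq (w : ℂ) (k : ℕ) : ∀ z, z ≠ w →
    iteratedDeriv k (fun z => 1 / (w - z) ^ 2) z = (k + 1).factorial / (w - z) ^ (k + 2) := by
  induction k with
  | zero => simp
  | succ k ih =>
    intro z hz
    have h1 : iteratedDeriv k (fun z => 1 / (w - z) ^ 2) =ᶠ[𝓝 z]
        fun z => ((k + 1).factorial : ℂ) / (w - z) ^ (k + 2) := by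
      filter_upwards [isOpen_ne.mem_nhds hz] with u hu using ih u hu
    have hz' : w - z ≠ 0 := sub_ne_zero.2 hz.symm
    have h2 : HasDerivAt (fun z => (w - z) ^ (k + 2)) (((k + 2 : ℕ) : ℂ) * (w - z) ^ (k + 1) * -1) z :=
      ((hasDerivAt_id z).const_sub w).pow (k + 2)
    have h3 := (hasDerivAt_const z ((k + 1).factorial : ℂ)).fun_div h2 (pow_ne_zero _ hz')
    rw [iteratedDeriv_succ, h1.deriv_eq, h3.deriv, Nat.factorial_succ (k + 1)]
    push_cast
    field_simp
    ring

/-- For fixed `w ≠ c` the double pole `1 / (w - z)^2` is holomorphic in `z` at `c`, and its Taylor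
coefficients there carry the whole singularity in `w`. -/
theorem exists_taylorCoeff_diagonal {b h : ℂ × ℂ → ℂ} {c : ℂ} (hh : AnalyticAt ℂ h (c, c))
    (hb : ∀ᶠ p in 𝓝 (c, c), p.1 ≠ p.2 → b p = 1 / (p.1 - p.2) ^ 2 + h p) (k : ℕ) :
    ∃ H : ℂ → ℂ, AnalyticAt ℂ H c ∧ ∀ᶠ w in 𝓝[≠] c,
      taylorCoeff (fun z => b (w, z)) c k = (k + 1) / (w - c) ^ (k + 2) + H w := by
  obtain ⟨H, hH, he⟩ := exists_taylorCoeff_snd hh k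
  refine ⟨H, hH, ?_⟩
  have hc : Tendsto (fun w : ℂ => (w, c)) (𝓝 c) (𝓝 (c, c)) := by
    have : ContinuousAt (fun w : ℂ => (w, c)) c := by fun_prop
    exact this
  filter_upwards [he.filter_mono nhdsWithin_le_nhds,
    -- A Taylor coefficient in `z` needs the formula for `b` on a full neighbourhood of `(w, c)`,
    -- not only at that point.
    (hc.eventually hb.eventually_nhds).filter_mono nhdsWithin_le_nhds,
    (hc.eventually hh.eventually_analyticAt).filter_mono nhdsWithin_le_nhds,
    self_mem_nhdsWithin] with w h1 h2 h3 h4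
  have h4 : w ≠ c := h4
  have hz : Tendsto (fun z : ℂ => (w, z)) (𝓝 c) (𝓝 (w, c)) := by
    have : ContinuousAt (fun z : ℂ => (w, z)) c := by fun_prop
    exact this
  have h5 : (fun z => b (w, z)) =ᶠ[𝓝 c] fun z => 1 / (w - z) ^ 2 + h (w, z) := by
    filter_upwards [hz.eventually h2, isOpen_ne.mem_nhds h4.symm] with z h6 h7
    exact h6 (Ne.symm h7)
  have h6 : AnalyticAt ℂ (fun z => h (w, z)) c :=
    AnalyticAt.comp (f := fun z : ℂ => (w, z)) h3 (by fun_prop)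
  have h7 : AnalyticAt ℂ (fun z => 1 / (w - z) ^ 2) c :=
    AnalyticAt.div (by fun_prop) (by fun_prop) (pow_ne_zero _ (sub_ne_zero.2 h4))
  rw [taylorCoeff_congr h5, taylorCoeff_add h7 h6, h1, taylorCoeff,
    iteratedDeriv_one_div_sub_sq w k c h4.symm, Nat.factorial_succ]
  have : (k.factorial : ℂ) ≠ 0 := by exact_mod_cast k.factorial_ne_zero
  push_cast
  field_simp

/-! ### The local geometry of a spectral curve -/

section LocalGeometry

variable {S : Type*} [TopologicalSpace S] [ChartedSpace ℂ S]

/-- The chain rule for the chart composed with its inverse shows that the derivative of the inverse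
is injective. -/
theorem coordVec_snd_ne_zero [IsManifold 𝓘(ℂ) ω S] (p : S) :
    (coordVec p (chartAt ℂ p p)).snd ≠ 0 := by
  have hmem : chartAt ℂ p p ∈ (chartAt ℂ p).target := mem_chart_target ℂ p
  have h1 : HasMFDerivAt 𝓘(ℂ) 𝓘(ℂ) (chartAt ℂ p).symm (chartAt ℂ p p)
      (mfderiv 𝓘(ℂ) 𝓘(ℂ) (chartAt ℂ p).symm (chartAt ℂ p p)) :=
    (mdifferentiableAt_atlas_symm (chart_mem_atlas ℂ p) hmem).hasMFDerivAt
  have h2 : HasMFDerivAt 𝓘(ℂ) 𝓘(ℂ) (chartAt ℂ p) ((chartAt ℂ p).symm (chartAt ℂ p p))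
      (mfderiv 𝓘(ℂ) 𝓘(ℂ) (chartAt ℂ p) ((chartAt ℂ p).symm (chartAt ℂ p p))) :=
    (mdifferentiableAt_atlas (chart_mem_atlas ℂ p)
      ((chartAt ℂ p).map_target hmem)).hasMFDerivAt
  have h3 := (HasMFDerivAt.comp _ h2 h1).hasFDerivAt
  let A : ℂ →L[ℂ] ℂ :=
    mfderiv 𝓘(ℂ) 𝓘(ℂ) (chartAt ℂ p) ((chartAt ℂ p).symm (chartAt ℂ p p))
  let L : ℂ →L[ℂ] ℂ := mfderiv 𝓘(ℂ) 𝓘(ℂ) (chartAt ℂ p).symm (chartAt ℂ p p)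
  have h4 : HasFDerivAt (chartAt ℂ p ∘ (chartAt ℂ p).symm) (A.comp L) (chartAt ℂ p p) := h3
  have h5 : HasFDerivAt (chartAt ℂ p ∘ (chartAt ℂ p).symm) (ContinuousLinearMap.id ℂ ℂ)
      (chartAt ℂ p p) := by
    refine (hasFDerivAt_id _).congr_of_eventuallyEq ?_
    filter_upwards [(chartAt ℂ p).open_target.mem_nhds hmem] with w hw
      using (chartAt ℂ p).right_inv hw
  have h6 : A (L 1) = 1 := congrArg (fun T : ℂ →L[ℂ] ℂ => T 1) (h4.unique h5)
  intro h7
  have h8 : L 1 = 0 := h7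
  rw [h8, map_zero] at h6
  exact zero_ne_one h6

namespace SpectralCurve

variable (C : SpectralCurve S)

/-- A tangent vector at a point which is not critical. -/
def IsNoncritical (u : TangentBundle 𝓘(ℂ) S) : Prop := ∀ γ, u.proj ≠ C.crit γ

/-- The `k`-th Taylor coefficient at `z^β` of the Bergman kernel in its second argument. -/
def bergmanCoeff (β : Fin C.N) (k : ℕ) (u : TangentBundle 𝓘(ℂ) S) : ℂ :=
  taylorCoeff (fun w => C.bergman u (C.vec β w)) (C.center β) k

theorem center_mem_target (β : Fin C.N) : C.center β ∈ (chartAt ℂ (C.crit β)).target :=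
  mem_chart_target ℂ (C.crit β)

theorem symm_center (β : Fin C.N) : (chartAt ℂ (C.crit β)).symm (C.center β) = C.crit β :=
  (chartAt ℂ (C.crit β)).left_inv (mem_chart_source ℂ (C.crit β))

theorem tendsto_vec_proj (β : Fin C.N) :
    Tendsto (fun w => (C.vec β w).proj) (𝓝 (C.center β)) (𝓝 (C.crit β)) := by
  have := ((chartAt ℂ (C.crit β)).continuousAt_symm (C.center_mem_target β)).tendsto
  rwa [C.symm_center] at this

theorem eventually_isNoncritical_vec [T2Space S] (β : Fin C.N) :
    ∀ᶠ w in 𝓝[≠] C.center β, C.IsNoncritical (C.vec β w) := by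
  refine eventually_all.2 fun γ => ?_
  by_cases h : γ = β
  · subst h
    filter_upwards [self_mem_nhdsWithin, nhdsWithin_le_nhds
      ((chartAt ℂ (C.crit γ)).open_target.mem_nhds (C.center_mem_target γ))] with w hw1 hw2 hw3
    have h1 : (chartAt ℂ (C.crit γ)).symm w = C.crit γ := hw3
    exact hw1 (by rw [Set.mem_singleton_iff, ← (chartAt ℂ (C.crit γ)).right_inv hw2, h1]; rfl)
  · exact ((C.tendsto_vec_proj β).eventually_ne
      (C.crit_injective.ne (Ne.symm h))).filter_mono nhdsWithin_le_nhds

theorem hasDerivAt_comp_vec_proj [IsManifold 𝓘(ℂ) ω S] {f : S → ℂ}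
    {df : ∀ p : S, TangentSpace 𝓘(ℂ) p →L[ℂ] ℂ} {β : Fin C.N}
    (hf : ∀ᶠ p in 𝓝 (C.crit β), HasMFDerivAt 𝓘(ℂ) 𝓘(ℂ) f p (df p)) :
    ∀ᶠ w in 𝓝 (C.center β), HasDerivAt (fun w => f (C.vec β w).proj) (coeff df (C.crit β) w) w := by
  filter_upwards [(C.tendsto_vec_proj β).eventually hf,
    (chartAt ℂ (C.crit β)).open_target.mem_nhds (C.center_mem_target β)] with w h1 h2
  have h3 : HasMFDerivAt 𝓘(ℂ) 𝓘(ℂ) (chartAt ℂ (C.crit β)).symm w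
      (mfderiv 𝓘(ℂ) 𝓘(ℂ) (chartAt ℂ (C.crit β)).symm w) :=
    (mdifferentiableAt_atlas_symm (chart_mem_atlas ℂ (C.crit β)) h2).hasMFDerivAt
  have h4 := (HasMFDerivAt.comp w h1 h3).hasFDerivAt
  let L : ℂ →L[ℂ] ℂ :=
    ContinuousLinearMap.comp (df ((chartAt ℂ (C.crit β)).symm w))
      (mfderiv 𝓘(ℂ) 𝓘(ℂ) (chartAt ℂ (C.crit β)).symm w)
  have h5 : HasFDerivAt (fun w => f (C.vec β w).proj) L w := h4
  exact h5.hasDerivAt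

theorem analyticAt_comp_vec_proj [IsManifold 𝓘(ℂ) ω S] {f : S → ℂ}
    {df : ∀ p : S, TangentSpace 𝓘(ℂ) p →L[ℂ] ℂ} {β : Fin C.N}
    (hf : ∀ᶠ p in 𝓝 (C.crit β), HasMFDerivAt 𝓘(ℂ) 𝓘(ℂ) f p (df p)) :
    AnalyticAt ℂ (fun w => f (C.vec β w).proj) (C.center β) :=
  Complex.analyticAt_iff_eventually_differentiableAt.2
    ((C.hasDerivAt_comp_vec_proj hf).mono fun _ h => h.differentiableAt)

theorem analyticAt_x [IsManifold 𝓘(ℂ) ω S] (β : Fin C.N) :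
    AnalyticAt ℂ (fun w => C.x (C.vec β w).proj) (C.center β) :=
  C.analyticAt_comp_vec_proj (C.hasMFDerivAt_x β)

theorem hasMFDerivAt_y (β : Fin C.N) : ∀ᶠ p in 𝓝 (C.crit β), HasMFDerivAt 𝓘(ℂ) 𝓘(ℂ) C.y p
    ((fun p => mfderiv 𝓘(ℂ) 𝓘(ℂ) C.y p : ∀ p : S, TangentSpace 𝓘(ℂ) p →L[ℂ] ℂ) p) :=
  (C.mdifferentiableAt_y β).mono fun _ h => h.hasMFDerivAt

theorem analyticAt_y [IsManifold 𝓘(ℂ) ω S] (β : Fin C.N) :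
    AnalyticAt ℂ (fun w => C.y (C.vec β w).proj) (C.center β) :=
  C.analyticAt_comp_vec_proj (C.hasMFDerivAt_y β)

theorem deriv_y_ne_zero [IsManifold 𝓘(ℂ) ω S] (β : Fin C.N) :
    deriv (fun w => C.y (C.vec β w).proj) (C.center β) ≠ 0 := by
  rw [(C.hasDerivAt_comp_vec_proj (C.hasMFDerivAt_y β)).self_of_nhds.deriv]
  -- The tangent vector is kept general so that its base point, on which its type depends, can be
  -- replaced by `C.crit β`.
  have key : ∀ X : TangentBundle 𝓘(ℂ) S, X.proj = C.crit β → X.snd ≠ 0 →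
      (mfderiv 𝓘(ℂ) 𝓘(ℂ) C.y X.proj : TangentSpace 𝓘(ℂ) X.proj →L[ℂ] ℂ) X.snd ≠ 0 := by
    rintro ⟨p, e⟩ (rfl : p = C.crit β) he h0
    refine C.dy_ne_zero β ?_
    let L : ℂ →L[ℂ] ℂ := mfderiv 𝓘(ℂ) 𝓘(ℂ) C.y (C.crit β)
    let e' : ℂ := e
    have he' : e' ≠ 0 := he
    have h1 : L e' = 0 := h0
    have h2 : L = 0 := by
      ext
      have h3 : L e' = e' * L 1 := by
        rw [← smul_eq_mul, ← map_smul, smul_eq_mul, mul_one]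
      rw [h3] at h1
      simpa using (mul_eq_zero.1 h1).resolve_left he'
    exact h2
  exact key (coordVec (C.crit β) (C.center β)) (C.symm_center β) (coordVec_snd_ne_zero _)

theorem analyticAt_dxAt (β : Fin C.N) :
    AnalyticAt ℂ (fun w => C.dxAt (C.vec β w)) (C.center β) :=
  C.dx_analyticAt _ (C.crit_notMem_boundary β)

/-! ### The local involution. -/

theorem analyticAt_conj [IsManifold 𝓘(ℂ) ω S] (β : Fin C.N) :
    AnalyticAt ℂ (C.conj β) (C.center β) := (C.isLocalInvolution_conj β).analyticAt

theorem conj_center [IsManifold 𝓘(ℂ) ω S] (β : Fin C.N) :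
    C.conj β (C.center β) = C.center β := (C.isLocalInvolution_conj β).map_center

theorem tendsto_conj [IsManifold 𝓘(ℂ) ω S] (β : Fin C.N) :
    Tendsto (C.conj β) (𝓝 (C.center β)) (𝓝 (C.center β)) := by
  simpa [C.conj_center] using (C.analyticAt_conj β).continuousAt.tendsto

theorem tendsto_conj_punctured [IsManifold 𝓘(ℂ) ω S] (β : Fin C.N) :
    Tendsto (C.conj β) (𝓝[≠] C.center β) (𝓝[≠] C.center β) := by
  refine tendsto_nhdsWithin_iff.2 ⟨(C.tendsto_conj β).mono_left nhdsWithin_le_nhds, ?_⟩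
  filter_upwards [(C.isLocalInvolution_conj β).involutive.filter_mono nhdsWithin_le_nhds,
    self_mem_nhdsWithin] with w h1 h2 h3
  rw [Set.mem_singleton_iff.1 h3, C.conj_center] at h1
  exact h2 h1.symm

theorem AnalyticAt.comp_conj [IsManifold 𝓘(ℂ) ω S] {C : SpectralCurve S} {β : Fin C.N} {f : ℂ → ℂ}
    (hf : AnalyticAt ℂ f (C.center β)) : AnalyticAt ℂ (fun w => f (C.conj β w)) (C.center β) := by
  have : AnalyticAt ℂ f (C.conj β (C.center β)) := by rwa [C.conj_center]
  exact this.comp (f := C.conj β) (C.analyticAt_conj β)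

theorem MeromorphicAt.comp_conj [IsManifold 𝓘(ℂ) ω S] {C : SpectralCurve S} {β : Fin C.N}
    {f : ℂ → ℂ} (hf : MeromorphicAt f (C.center β)) :
    MeromorphicAt (fun w => f (C.conj β w)) (C.center β) := by
  have : MeromorphicAt f (C.conj β (C.center β)) := by rwa [C.conj_center]
  exact this.comp_analyticAt (C.analyticAt_conj β)

theorem eventually_isNoncritical_conjVec [T2Space S] [IsManifold 𝓘(ℂ) ω S] (β : Fin C.N) :
    ∀ᶠ w in 𝓝[≠] C.center β, C.IsNoncritical (C.conjVec β w) :=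
  (C.tendsto_conj_punctured β).eventually (C.eventually_isNoncritical_vec β)

theorem x_conjVec [IsManifold 𝓘(ℂ) ω S] (β : Fin C.N) :
    ∀ᶠ w in 𝓝 (C.center β), C.x (C.conjVec β w).proj = C.x (C.vec β w).proj :=
  (C.isLocalInvolution_conj β).comp_eq

/-- Since `dy ≠ 0` at `z^β`, the function `y` is injective nearby, while `z̄ ≠ z` off the centre. -/
theorem y_sub_y_conjVec_ne_zero [IsManifold 𝓘(ℂ) ω S] (β : Fin C.N) :
    ∀ᶠ w in 𝓝[≠] C.center β, C.y (C.vec β w).proj - C.y (C.conjVec β w).proj ≠ 0 := by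
  obtain ⟨U, hU, hinj⟩ : ∃ U ∈ 𝓝 (C.center β),
      Set.InjOn (fun w => C.y (C.vec β w).proj) U := by
    have h := (C.analyticAt_y β).hasStrictDerivAt.hasStrictFDerivAt_equiv (C.deriv_y_ne_zero β)
    exact ⟨_, (h.toOpenPartialHomeomorph _).open_source.mem_nhds h.mem_toOpenPartialHomeomorph_source,
      (h.toOpenPartialHomeomorph _).injOn⟩
  filter_upwards [(C.isLocalInvolution_conj β).ne_self, nhdsWithin_le_nhds hU,
    ((C.tendsto_conj β).eventually hU).filter_mono nhdsWithin_le_nhds] with w h1 h2 h3 h4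
  exact h1 (hinj h3 h2 (sub_eq_zero.1 h4).symm)

/-! ### The Bergman kernel near the critical points. -/

/-- Tangent spaces are one-dimensional. This passes from coordinate vectors, for which analyticity
of `B` is assumed, to arbitrary tangent vectors. -/
theorem bergman_eq_mul_bergman_coordVec [IsManifold 𝓘(ℂ) ω S] (u : TangentBundle 𝓘(ℂ) S) :
    ∃ a : ℂ, ∀ v, C.bergman u v = a * C.bergman (coordVec u.proj (chartAt ℂ u.proj u.proj)) v := by
  have key : ∀ X Y : TangentBundle 𝓘(ℂ) S, Y.proj = X.proj → Y.snd ≠ 0 →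
      ∃ a : ℂ, ∀ v, C.bergman X v = a * C.bergman Y v := by
    rintro ⟨p, e⟩ ⟨q, f⟩ (rfl : q = p) hf
    let e' : ℂ := e
    let f' : ℂ := f
    have hf' : f' ≠ 0 := hf
    refine ⟨e' / f', fun v => ?_⟩
    let L : ℂ →L[ℂ] TangentSpace 𝓘(ℂ) v.proj →L[ℂ] ℂ := C.B q v.proj
    have h1 : e' = (e' / f') • f' := by
      rw [smul_eq_mul, div_mul_cancel₀ _ hf']
    have h2 : L e' v.snd = e' / f' * L f' v.snd := by
      conv_lhs => rw [h1, map_smul]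
      rfl
    exact h2
  exact key u _ ((chartAt ℂ u.proj).left_inv (mem_chart_source ℂ u.proj)) (coordVec_snd_ne_zero _)

variable {C}

theorem IsNoncritical.analyticAt_bergman [IsManifold 𝓘(ℂ) ω S] {u : TangentBundle 𝓘(ℂ) S}
    (hu : C.IsNoncritical u) (β : Fin C.N) :
    AnalyticAt ℂ (fun w => C.bergman u (C.vec β w)) (C.center β) := by
  obtain ⟨a, ha⟩ := C.bergman_eq_mul_bergman_coordVec u
  have h1 := C.isFundamentalBidifferential_B.analyticAt _ _ (hu β)
  have h2 : AnalyticAt ℂ (fun w => bicoeff C.B u.proj (C.crit β) (chartAt ℂ u.proj u.proj, w))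
      (C.center β) :=
    AnalyticAt.comp (f := fun w : ℂ => (chartAt ℂ u.proj u.proj, w)) h1 (by fun_prop)
  simp only [ha]
  exact analyticAt_const.mul h2

theorem IsNoncritical.bergman_comm {u : TangentBundle 𝓘(ℂ) S} [T2Space S]
    (hu : C.IsNoncritical u) (β : Fin C.N) :
    ∀ᶠ w in 𝓝 (C.center β), C.bergman (C.vec β w) u = C.bergman u (C.vec β w) := by
  filter_upwards [(C.tendsto_vec_proj β).eventually_ne (hu β).symm] with w hw
  exact C.isFundamentalBidifferential_B.symm _ _ hw _ _

variable (C)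

theorem bergman_conjVec_left (β : Fin C.N) (w : ℂ) (u : TangentBundle 𝓘(ℂ) S) :
    C.bergman (C.conjVec β w) u = deriv (C.conj β) w * C.bergman (C.vec β (C.conj β w)) u := by
  unfold bergman conjVec
  simp only
  rw [map_smul]
  rfl

theorem bergman_conjVec_right (β : Fin C.N) (w : ℂ) (u : TangentBundle 𝓘(ℂ) S) :
    C.bergman u (C.conjVec β w) = deriv (C.conj β) w * C.bergman u (C.vec β (C.conj β w)) := by
  unfold bergman conjVec
  simp only
  rw [map_smul]
  rfl

/-- This is the term `ω_{0,2}(z, z̄)` of the bracket with `g = 1`, `n = 0`. Both arguments tend to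
the same point, so the diagonal form of `B` is evaluated along the graph of the involution. -/
theorem meromorphicAt_bergman_vec_conjVec [IsManifold 𝓘(ℂ) ω S] (β : Fin C.N) :
    MeromorphicAt (fun w => C.bergman (C.vec β w) (C.conjVec β w)) (C.center β) := by
  obtain ⟨h, hh, hb⟩ := C.isFundamentalBidifferential_B.diagonal (C.crit β)
  have hh' : AnalyticAt ℂ (fun w => h (w, C.conj β w)) (C.center β) := by
    have : AnalyticAt ℂ h ((fun w => (w, C.conj β w)) (C.center β)) := by
      simp only [C.conj_center]; exact hh
    exact this.comp (f := fun w => (w, C.conj β w)) (analyticAt_id.prod (C.analyticAt_conj β))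
  have hc : Tendsto (fun w => (w, C.conj β w)) (𝓝 (C.center β))
      (𝓝 (C.center β, C.center β)) := tendsto_id.prodMk_nhds (C.tendsto_conj β)
  have hm : MeromorphicAt (fun w => deriv (C.conj β) w *
      (1 / (w - C.conj β w) ^ 2 + h (w, C.conj β w))) (C.center β) := by
    refine (C.analyticAt_conj β).deriv.meromorphicAt.mul (MeromorphicAt.add ?_ hh'.meromorphicAt)
    exact MeromorphicAt.div (.const 1 _)
      ((analyticAt_id.sub (C.analyticAt_conj β)).pow 2).meromorphicAt
  refine hm.congr ?_
  filter_upwards [(hc.eventually hb).filter_mono nhdsWithin_le_nhds,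
    (C.isLocalInvolution_conj β).ne_self] with w h1 h2
  rw [C.bergman_conjVec_right, ← h1 (Ne.symm h2)]
  rfl

/-! ### Singularities of the Taylor coefficients of the Bergman kernel. -/

theorem bergmanCoeff_vec_of_ne {β γ : Fin C.N} (h : γ ≠ β) (k : ℕ) :
    ∃ H : ℂ → ℂ, AnalyticAt ℂ H (C.center γ) ∧
      ∀ᶠ w in 𝓝 (C.center γ), C.bergmanCoeff β k (C.vec γ w) = H w :=
  exists_taylorCoeff_snd
    (C.isFundamentalBidifferential_B.analyticAt _ _ (C.crit_injective.ne h)) k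

theorem bergmanCoeff_vec_self (β : Fin C.N) (k : ℕ) :
    ∃ H : ℂ → ℂ, AnalyticAt ℂ H (C.center β) ∧ ∀ᶠ w in 𝓝[≠] C.center β,
      C.bergmanCoeff β k (C.vec β w) = (k + 1) / (w - C.center β) ^ (k + 2) + H w := by
  obtain ⟨h, hh, hb⟩ := C.isFundamentalBidifferential_B.diagonal (C.crit β)
  exact exists_taylorCoeff_diagonal hh hb k

theorem meromorphicAt_bergmanCoeff_vec (β γ : Fin C.N) (k : ℕ) :
    MeromorphicAt (fun w => C.bergmanCoeff β k (C.vec γ w)) (C.center γ) := by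
  by_cases h : γ = β
  · subst h
    obtain ⟨H, hH, he⟩ := C.bergmanCoeff_vec_self γ k
    have hm : MeromorphicAt (fun w => ((k : ℂ) + 1) / (w - C.center γ) ^ (k + 2) + H w)
        (C.center γ) := by
      refine MeromorphicAt.add (MeromorphicAt.div (.const _ _) ?_) hH.meromorphicAt
      exact AnalyticAt.meromorphicAt (by fun_prop)
    exact hm.congr (he.mono fun _ h => h.symm)
  · obtain ⟨H, hH, he⟩ := C.bergmanCoeff_vec_of_ne h k
    exact hH.meromorphicAt.congr ((he.mono fun _ h => h.symm).filter_mono nhdsWithin_le_nhds)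

theorem bergmanCoeff_conjVec [T2Space S] [IsManifold 𝓘(ℂ) ω S] (β γ : Fin C.N) (k : ℕ) :
    ∀ᶠ w in 𝓝[≠] C.center γ, C.bergmanCoeff β k (C.conjVec γ w) =
      deriv (C.conj γ) w * C.bergmanCoeff β k (C.vec γ (C.conj γ w)) := by
  filter_upwards [(C.tendsto_conj_punctured γ).eventually
    (C.eventually_isNoncritical_vec γ)] with w hw
  simp only [bergmanCoeff, taylorCoeff, C.bergman_conjVec_left]
  rw [iteratedDeriv_const_mul _ (hw.analyticAt_bergman β).contDiffAt, mul_div_assoc]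

theorem meromorphicAt_bergmanCoeff_conjVec [T2Space S] [IsManifold 𝓘(ℂ) ω S]
    (β γ : Fin C.N) (k : ℕ) :
    MeromorphicAt (fun w => C.bergmanCoeff β k (C.conjVec γ w)) (C.center γ) :=
  ((C.analyticAt_conj γ).deriv.meromorphicAt.mul
    (MeromorphicAt.comp_conj (C.meromorphicAt_bergmanCoeff_vec β γ k))).congr
    ((C.bergmanCoeff_conjVec β γ k).mono fun _ h => h.symm)

variable {C}

theorem IsNoncritical.exists_bergmanIntegral_eq [IsManifold 𝓘(ℂ) ω S] {u : TangentBundle 𝓘(ℂ) S}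
    (hu : C.IsNoncritical u) (β : Fin C.N) :
    ∃ F : ℂ → ℂ, AnalyticAt ℂ F (C.center β) ∧ taylorCoeff F (C.center β) 0 = 0 ∧
      (∀ k, taylorCoeff F (C.center β) (k + 1) = C.bergmanCoeff β k u / (k + 1)) ∧
      ∀ᶠ w in 𝓝 (C.center β), C.bergmanIntegral β u w = F w - F (C.conj β w) := by
  obtain ⟨F, h1, h2, h3, h4⟩ := exists_primitive (hu.analyticAt_bergman β)
  have hc : Tendsto (fun w => (w, C.conj β w)) (𝓝 (C.center β))
      (𝓝 (C.center β, C.center β)) := tendsto_id.prodMk_nhds (C.tendsto_conj β)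
  exact ⟨F, h1, h2, h3, hc.eventually h4⟩

end SpectralCurve

end LocalGeometry

/-! ### Polynomials in the Taylor coefficients of the Bergman kernel -/

section BergmanPolynomials

variable {S : Type*} [TopologicalSpace S] [ChartedSpace ℂ S]

namespace SpectralCurve

/-- Functions of a family of tangent vectors which, away from the critical points, are polynomials
in the Taylor coefficients of the Bergman kernel at the critical points. -/
inductive IsBergmanPoly (C : SpectralCurve S) {ι : Type} :
    ((ι → TangentBundle 𝓘(ℂ) S) → ℂ) → Prop
  | const (a : ℂ) : IsBergmanPoly C fun _ => a
  | coeff (β : Fin C.N) (k : ℕ) (i : ι) : IsBergmanPoly C fun v => C.bergmanCoeff β k (v i)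
  | add {F G} : IsBergmanPoly C F → IsBergmanPoly C G → IsBergmanPoly C fun v => F v + G v
  | mul {F G} : IsBergmanPoly C F → IsBergmanPoly C G → IsBergmanPoly C fun v => F v * G v
  | congr {F G} : IsBergmanPoly C F → (∀ v, (∀ i, C.IsNoncritical (v i)) → F v = G v) →
      IsBergmanPoly C G

variable {C : SpectralCurve S} {ι κ : Type}

namespace IsBergmanPoly

theorem sum {J : Type*} {s : Finset J} {F : J → (ι → TangentBundle 𝓘(ℂ) S) → ℂ}
    (h : ∀ j ∈ s, IsBergmanPoly C (F j)) : IsBergmanPoly C fun v => ∑ j ∈ s, F j v := by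
  classical
  induction s using Finset.induction_on with
  | empty => simpa using const 0
  | insert j s hj ih =>
    simp only [Finset.sum_insert hj]
    exact (h j (by simp)).add (ih fun i hi => h i (by simp [hi]))

theorem reindex (e : κ → ι) {F : (κ → TangentBundle 𝓘(ℂ) S) → ℂ} (h : IsBergmanPoly C F) :
    IsBergmanPoly C fun v : ι → TangentBundle 𝓘(ℂ) S => F fun k => v (e k) := by
  induction h with
  | const a => exact const a
  | coeff β k i => exact coeff β k (e i)
  | add _ _ h1 h2 => exact h1.add h2
  | mul _ _ h1 h2 => exact h1.mul h2
  | congr _ he h => exact h.congr fun v hv => he _ fun i => hv _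

end IsBergmanPoly

/-- Functions of `w` and of tangent vectors which for `w` near `z^β` can be expanded to any order
in `w` with coefficients that are polynomials in the Taylor coefficients of the Bergman kernel. -/
def HasExpansion (C : SpectralCurve S) (β : Fin C.N)
    (Q : ℂ → (ι → TangentBundle 𝓘(ℂ) S) → ℂ) : Prop :=
  ∀ K : ℕ, ∃ (J : Type) (_ : Fintype J) (a : J → (ι → TangentBundle 𝓘(ℂ) S) → ℂ)
    (g : J → ℂ → ℂ), (∀ j, IsBergmanPoly C (a j)) ∧ (∀ j, AnalyticAt ℂ (g j) (C.center β)) ∧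
    ∀ v, (∀ i, C.IsNoncritical (v i)) → ∃ ψ : ℂ → ℂ, AnalyticAt ℂ ψ (C.center β) ∧
      ∀ᶠ w in 𝓝[≠] C.center β, Q w v = ∑ j, a j v * g j w + (w - C.center β) ^ K * ψ w

namespace HasExpansion

variable {β : Fin C.N} {Q R : ℂ → (ι → TangentBundle 𝓘(ℂ) S) → ℂ}

theorem congr (h : C.HasExpansion β Q) (he : ∀ v, (∀ i, C.IsNoncritical (v i)) →
    ∀ᶠ w in 𝓝[≠] C.center β, Q w v = R w v) : C.HasExpansion β R := by
  intro K
  obtain ⟨J, hJ, a, g, ha, hg, h⟩ := h K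
  refine ⟨J, hJ, a, g, ha, hg, fun v hv => ?_⟩
  obtain ⟨ψ, hψ, h⟩ := h v hv
  refine ⟨ψ, hψ, ?_⟩
  filter_upwards [h, he v hv] with w h1 h2
  rw [← h2, h1]

theorem of_mul {a : (ι → TangentBundle 𝓘(ℂ) S) → ℂ} (ha : IsBergmanPoly C a) {g : ℂ → ℂ}
    (hg : AnalyticAt ℂ g (C.center β)) : C.HasExpansion β fun w v => a v * g w := by
  refine fun K => ⟨Unit, inferInstance, fun _ => a, fun _ => g, fun _ => ha, fun _ => hg,
    fun v _ => ⟨fun _ => 0, analyticAt_const, ?_⟩⟩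
  simp

theorem of_analyticAt {g : ℂ → ℂ} (hg : AnalyticAt ℂ g (C.center β)) :
    C.HasExpansion β fun w (_ : ι → TangentBundle 𝓘(ℂ) S) => g w :=
  (of_mul (.const 1) hg).congr fun _ _ => by simp

theorem of_isBergmanPoly {a : (ι → TangentBundle 𝓘(ℂ) S) → ℂ} (ha : IsBergmanPoly C a) :
    C.HasExpansion β fun _ v => a v :=
  (of_mul ha (analyticAt_const (v := 1))).congr fun _ _ => by simp

theorem of_taylorCoeff {φ : (ι → TangentBundle 𝓘(ℂ) S) → ℂ → ℂ}
    {a : ℕ → (ι → TangentBundle 𝓘(ℂ) S) → ℂ} (ha : ∀ k, IsBergmanPoly C (a k))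
    (hφ : ∀ v, (∀ i, C.IsNoncritical (v i)) → AnalyticAt ℂ (φ v) (C.center β))
    (h : ∀ v, (∀ i, C.IsNoncritical (v i)) → ∀ k, taylorCoeff (φ v) (C.center β) k = a k v) :
    C.HasExpansion β fun w v => φ v w := by
  refine fun K => ⟨Fin K, inferInstance, fun k => a k, fun k w => (w - C.center β) ^ (k : ℕ),
    fun k => ha k, fun k => by fun_prop, fun v hv => ?_⟩
  obtain ⟨ψ, hψ, he⟩ := exists_taylor_remainder (hφ v hv) K
  refine ⟨ψ, hψ, Eventually.of_forall fun w => ?_⟩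
  simp only [he w, Finset.sum_range, h v hv]

theorem add (hQ : C.HasExpansion β Q) (hR : C.HasExpansion β R) :
    C.HasExpansion β fun w v => Q w v + R w v := by
  intro K
  obtain ⟨J₁, _, a₁, g₁, ha₁, hg₁, h₁⟩ := hQ K
  obtain ⟨J₂, _, a₂, g₂, ha₂, hg₂, h₂⟩ := hR K
  refine ⟨J₁ ⊕ J₂, inferInstance, Sum.elim a₁ a₂, Sum.elim g₁ g₂, ?_, ?_, fun v hv => ?_⟩
  · rintro (j | j)
    exacts [ha₁ j, ha₂ j]
  · rintro (j | j)
    exacts [hg₁ j, hg₂ j]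
  · obtain ⟨ψ₁, hψ₁, e₁⟩ := h₁ v hv
    obtain ⟨ψ₂, hψ₂, e₂⟩ := h₂ v hv
    refine ⟨fun w => ψ₁ w + ψ₂ w, hψ₁.add hψ₂, ?_⟩
    filter_upwards [e₁, e₂] with w h1 h2
    simp only [h1, h2, Fintype.sum_sum_type, Sum.elim_inl, Sum.elim_inr]
    ring

theorem mul (hQ : C.HasExpansion β Q) (hR : C.HasExpansion β R) :
    C.HasExpansion β fun w v => Q w v * R w v := by
  intro K
  obtain ⟨J₁, _, a₁, g₁, ha₁, hg₁, h₁⟩ := hQ K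
  obtain ⟨J₂, _, a₂, g₂, ha₂, hg₂, h₂⟩ := hR K
  refine ⟨J₁ × J₂, inferInstance, fun j v => a₁ j.1 v * a₂ j.2 v, fun j w => g₁ j.1 w * g₂ j.2 w,
    fun j => (ha₁ _).mul (ha₂ _), fun j => (hg₁ _).mul (hg₂ _), fun v hv => ?_⟩
  obtain ⟨ψ₁, hψ₁, e₁⟩ := h₁ v hv
  obtain ⟨ψ₂, hψ₂, e₂⟩ := h₂ v hv
  -- These are the cross terms of the product of the two truncated expansions, with one factor `(w -
  -- c)^K` taken out, where `c` is the centre.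
  refine ⟨fun w => (∑ j, a₁ j v * g₁ j w) * ψ₂ w + ψ₁ w * (∑ j, a₂ j v * g₂ j w) +
    (w - C.center β) ^ K * ψ₁ w * ψ₂ w, ?_, ?_⟩
  · have s₁ : AnalyticAt ℂ (fun w => ∑ j, a₁ j v * g₁ j w) (C.center β) :=
      Finset.analyticAt_fun_sum _ fun j _ => analyticAt_const.mul (hg₁ j)
    have s₂ : AnalyticAt ℂ (fun w => ∑ j, a₂ j v * g₂ j w) (C.center β) :=
      Finset.analyticAt_fun_sum _ fun j _ => analyticAt_const.mul (hg₂ j)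
    have s₃ : AnalyticAt ℂ (fun w => (w - C.center β) ^ K) (C.center β) := by fun_prop
    exact ((s₁.mul hψ₂).add (hψ₁.mul s₂)).add ((s₃.mul hψ₁).mul hψ₂)
  · filter_upwards [e₁, e₂] with w h1 h2
    have h3 : ∑ j : J₁ × J₂, a₁ j.1 v * a₂ j.2 v * (g₁ j.1 w * g₂ j.2 w) =
        (∑ j, a₁ j v * g₁ j w) * ∑ j, a₂ j v * g₂ j w := by
      rw [Fintype.sum_mul_sum, Fintype.sum_prod_type]
      exact Finset.sum_congr rfl fun i _ => Finset.sum_congr rfl fun j _ => by ring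
    rw [h1, h2, h3]
    ring

theorem reindex (e : κ → ι) {Q : ℂ → (κ → TangentBundle 𝓘(ℂ) S) → ℂ}
    (h : C.HasExpansion β Q) :
    C.HasExpansion β fun w (v : ι → TangentBundle 𝓘(ℂ) S) => Q w fun k => v (e k) := by
  intro K
  obtain ⟨J, hJ, a, g, ha, hg, h⟩ := h K
  exact ⟨J, hJ, fun j v => a j fun k => v (e k), g, fun j => (ha j).reindex e, hg,
    fun v hv => h _ fun k => hv _⟩

theorem comp_conj [IsManifold 𝓘(ℂ) ω S] (h : C.HasExpansion β Q) :
    C.HasExpansion β fun w v => Q (C.conj β w) v := by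
  intro K
  obtain ⟨J, hJ, a, g, ha, hg, h⟩ := h K
  refine ⟨J, hJ, a, fun j w => g j (C.conj β w), ha, fun j => AnalyticAt.comp_conj (hg j),
    fun v hv => ?_⟩
  obtain ⟨ψ, hψ, he⟩ := h v hv
  -- As `σ` fixes the centre `c`, it satisfies `σ w - c = (w - c) q(w)`, so the remainder keeps its
  -- order `K` after composition.
  obtain ⟨q, hq, hq'⟩ := exists_taylor_remainder (C.analyticAt_conj β) 1
  refine ⟨fun w => q w ^ K * ψ (C.conj β w), (hq.pow K).mul (AnalyticAt.comp_conj hψ), ?_⟩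
  filter_upwards [(C.tendsto_conj_punctured β).eventually he] with w h1
  have h2 : C.conj β w - C.center β = (w - C.center β) * q w := by
    rw [hq' w]
    simp [taylorCoeff, C.conj_center]
  rw [h1, h2, mul_pow, mul_assoc]

/-- Symmetry of `B` moves the variable point to the second argument, where the Taylor coefficients
are taken. -/
theorem bergman_vec [T2Space S] [IsManifold 𝓘(ℂ) ω S] (i : ι) :
    C.HasExpansion β fun w v => C.bergman (C.vec β w) (v i) := by
  have h : C.HasExpansion β fun w (v : ι → TangentBundle 𝓘(ℂ) S) =>
      C.bergman (v i) (C.vec β w) :=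
    of_taylorCoeff (a := fun k v => C.bergmanCoeff β k (v i)) (fun k => .coeff β k i)
      (fun v hv => (hv i).analyticAt_bergman β) fun v _ k => rfl
  exact h.congr fun v hv => (((hv i).bergman_comm β).mono fun _ h => h.symm).filter_mono
    nhdsWithin_le_nhds

theorem bergman_conjVec [T2Space S] [IsManifold 𝓘(ℂ) ω S] (i : ι) :
    C.HasExpansion β fun w v => C.bergman (C.conjVec β w) (v i) := by
  simp only [C.bergman_conjVec_left]
  exact (of_analyticAt (C.analyticAt_conj β).deriv).mul (bergman_vec i).comp_conj

theorem bergmanIntegral [IsManifold 𝓘(ℂ) ω S] (i : ι) :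
    C.HasExpansion β fun w v => C.bergmanIntegral β (v i) w := by
  -- Noncriticality is put inside the existential, so that the primitive can be chosen as a function
  -- of every tangent vector. Its value at critical points is irrelevant.
  have hF : ∀ u : TangentBundle 𝓘(ℂ) S, ∃ F : ℂ → ℂ, C.IsNoncritical u →
      AnalyticAt ℂ F (C.center β) ∧ taylorCoeff F (C.center β) 0 = 0 ∧
      (∀ k, taylorCoeff F (C.center β) (k + 1) = C.bergmanCoeff β k u / (k + 1)) ∧
      ∀ᶠ w in 𝓝 (C.center β), C.bergmanIntegral β u w = F w - F (C.conj β w) := by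
    intro u
    by_cases hu : C.IsNoncritical u
    · obtain ⟨F, h⟩ := hu.exists_bergmanIntegral_eq β
      exact ⟨F, fun _ => h⟩
    · exact ⟨0, fun h => absurd h hu⟩
  choose F hF using hF
  have h : C.HasExpansion β fun w (v : ι → TangentBundle 𝓘(ℂ) S) => F (v i) w := by
    refine of_taylorCoeff (a := fun k v => Nat.casesOn k 0 fun k =>
      C.bergmanCoeff β k (v i) * (1 / (k + 1))) ?_ (fun v hv => (hF _ (hv i)).1) fun v hv k => ?_
    · rintro (_ | k)
      · exact .const 0
      · exact (IsBergmanPoly.coeff β k i).mul (.const _)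
    · cases k with
      | zero => exact (hF _ (hv i)).2.1
      | succ k => rw [(hF _ (hv i)).2.2.1 k, div_eq_mul_one_div]
  refine (h.add ((of_analyticAt (analyticAt_const (v := -1))).mul h.comp_conj)).congr
    fun v hv => ?_
  filter_upwards [(hF _ (hv i)).2.2.2.filter_mono nhdsWithin_le_nhds] with w hw
  rw [hw]
  ring

end HasExpansion

/-- Like `HasExpansion`, with a pole of bounded order allowed at `z^β`. -/
def HasLaurentExpansion (C : SpectralCurve S) (β : Fin C.N)
    (Q : ℂ → (ι → TangentBundle 𝓘(ℂ) S) → ℂ) : Prop :=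
  ∃ P : ℕ, C.HasExpansion β fun w v => (w - C.center β) ^ P * Q w v

theorem HasExpansion.hasLaurentExpansion {β : Fin C.N}
    {Q : ℂ → (ι → TangentBundle 𝓘(ℂ) S) → ℂ} (h : C.HasExpansion β Q) :
    C.HasLaurentExpansion β Q :=
  ⟨0, by simpa using h⟩

namespace HasLaurentExpansion

variable {β : Fin C.N} {Q R : ℂ → (ι → TangentBundle 𝓘(ℂ) S) → ℂ}

theorem congr (h : C.HasLaurentExpansion β Q) (he : ∀ v, (∀ i, C.IsNoncritical (v i)) →
    ∀ᶠ w in 𝓝[≠] C.center β, Q w v = R w v) : C.HasLaurentExpansion β R := by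
  obtain ⟨P, h⟩ := h
  refine ⟨P, h.congr fun v hv => ?_⟩
  filter_upwards [he v hv] with w hw
  rw [hw]

theorem of_meromorphicAt {f : ℂ → ℂ} (hf : MeromorphicAt f (C.center β)) :
    C.HasLaurentExpansion β fun w (_ : ι → TangentBundle 𝓘(ℂ) S) => f w := by
  obtain ⟨P, h⟩ := hf
  exact ⟨P, HasExpansion.of_analyticAt h⟩

theorem of_isBergmanPoly {a : (ι → TangentBundle 𝓘(ℂ) S) → ℂ} (ha : IsBergmanPoly C a) :
    C.HasLaurentExpansion β fun _ v => a v :=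
  (HasExpansion.of_isBergmanPoly ha).hasLaurentExpansion

theorem mul (hQ : C.HasLaurentExpansion β Q) (hR : C.HasLaurentExpansion β R) :
    C.HasLaurentExpansion β fun w v => Q w v * R w v := by
  obtain ⟨P₁, h₁⟩ := hQ
  obtain ⟨P₂, h₂⟩ := hR
  refine ⟨P₁ + P₂, (h₁.mul h₂).congr fun v _ => Eventually.of_forall fun w => ?_⟩
  ring

theorem add (hQ : C.HasLaurentExpansion β Q) (hR : C.HasLaurentExpansion β R) :
    C.HasLaurentExpansion β fun w v => Q w v + R w v := by
  obtain ⟨P₁, h₁⟩ := hQ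
  obtain ⟨P₂, h₂⟩ := hR
  have hp : ∀ P : ℕ, C.HasExpansion β fun w (_ : ι → TangentBundle 𝓘(ℂ) S) =>
      (w - C.center β) ^ P := fun P => .of_analyticAt (by fun_prop)
  refine ⟨P₁ + P₂, (((hp P₂).mul h₁).add ((hp P₁).mul h₂)).congr fun v _ =>
    Eventually.of_forall fun w => ?_⟩
  ring

theorem sum {J : Type*} {s : Finset J} {Q : J → ℂ → (ι → TangentBundle 𝓘(ℂ) S) → ℂ}
    (h : ∀ j ∈ s, C.HasLaurentExpansion β (Q j)) :
    C.HasLaurentExpansion β fun w v => ∑ j ∈ s, Q j w v := by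
  classical
  induction s using Finset.induction_on with
  | empty => simpa using of_isBergmanPoly (.const 0)
  | insert j s hj ih =>
    simp only [Finset.sum_insert hj]
    exact (h j (by simp)).add (ih fun i hi => h i (by simp [hi]))

theorem reindex (e : κ → ι) {Q : ℂ → (κ → TangentBundle 𝓘(ℂ) S) → ℂ}
    (h : C.HasLaurentExpansion β Q) :
    C.HasLaurentExpansion β fun w (v : ι → TangentBundle 𝓘(ℂ) S) => Q w fun k => v (e k) := by
  obtain ⟨P, h⟩ := h
  exact ⟨P, h.reindex e⟩

theorem meromorphicAt (h : C.HasLaurentExpansion β Q) {v : ι → TangentBundle 𝓘(ℂ) S}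
    (hv : ∀ i, C.IsNoncritical (v i)) : MeromorphicAt (fun w => Q w v) (C.center β) := by
  obtain ⟨P, h⟩ := h
  -- Order `0` suffices: only analyticity of the expanded function is needed here, not any decay of
  -- the remainder.
  obtain ⟨J, _, a, g, ha, hg, h⟩ := h 0
  obtain ⟨ψ, hψ, he⟩ := h v hv
  have hm : MeromorphicAt (fun w => (∑ j, a j v * g j w + (w - C.center β) ^ 0 * ψ w) /
      (w - C.center β) ^ P) (C.center β) := by
    refine MeromorphicAt.div (AnalyticAt.meromorphicAt ?_) (AnalyticAt.meromorphicAt (by fun_prop))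
    exact (Finset.analyticAt_fun_sum _ fun j _ => analyticAt_const.mul (hg j)).add
      (AnalyticAt.mul (by fun_prop) hψ)
  refine hm.congr ?_
  filter_upwards [he, self_mem_nhdsWithin] with w h1 h2
  rw [← h1, mul_div_cancel_left₀ _ (pow_ne_zero _ (sub_ne_zero.2 h2))]

/-- Expanding to the order `P` of the pole makes the remainder holomorphic after division, so it has
no residue. The functions `g j` do not depend on the tangent vectors, so the other terms contribute
constants times the polynomials `a j`. -/
theorem residue (h : C.HasLaurentExpansion β Q) :
    IsBergmanPoly C fun v => residue (fun w => Q w v) (C.center β) := by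
  obtain ⟨P, h⟩ := h
  obtain ⟨J, _, a, g, ha, hg, h⟩ := h P
  refine IsBergmanPoly.congr (F := fun v => ∑ j, a j v *
    TR.residue (fun w => g j w / (w - C.center β) ^ P) (C.center β))
    (IsBergmanPoly.sum fun j _ => (ha j).mul (.const _)) fun v hv => ?_
  obtain ⟨ψ, hψ, he⟩ := h v hv
  have h1 : ∀ j, MeromorphicAt (fun w => g j w / (w - C.center β) ^ P) (C.center β) := fun j =>
    MeromorphicAt.div (hg j).meromorphicAt (AnalyticAt.meromorphicAt (by fun_prop))
  have h2 := (HasResidue.sum (s := Finset.univ) fun j _ =>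
    (hasResidue_of_meromorphicAt (h1 j)).const_mul (a j v)).add (HasResidue.of_analyticAt hψ)
  rw [add_zero] at h2
  refine (h2.congr ?_).residue_eq.symm
  filter_upwards [he, self_mem_nhdsWithin] with w h1 h2
  have h3 : (w - C.center β) ^ P ≠ 0 := pow_ne_zero _ (sub_ne_zero.2 h2)
  rw [← mul_right_inj' h3, h1, mul_add, Finset.mul_sum]
  congr 1
  refine Finset.sum_congr rfl fun j _ => ?_
  field_simp

/-- Substitution of functions of `w` and of tangent vectors into a polynomial in the Taylor
coefficients of the Bergman kernel. -/
theorem subst {F : (κ → TangentBundle 𝓘(ℂ) S) → ℂ} (hF : IsBergmanPoly C F)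
    (s : ℂ → (ι → TangentBundle 𝓘(ℂ) S) → κ → TangentBundle 𝓘(ℂ) S)
    (hs : ∀ β' k i, C.HasLaurentExpansion β fun w v => C.bergmanCoeff β' k (s w v i))
    (hs' : ∀ v, (∀ i, C.IsNoncritical (v i)) →
      ∀ᶠ w in 𝓝[≠] C.center β, ∀ i, C.IsNoncritical (s w v i)) :
    C.HasLaurentExpansion β fun w v => F (s w v) := by
  induction hF with
  | const a => exact of_isBergmanPoly (.const a)
  | coeff β' k i => exact hs β' k i
  | add _ _ h1 h2 => exact h1.add h2
  | mul _ _ h1 h2 => exact h1.mul h2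
  | congr _ he h =>
    exact h.congr fun v hv => (hs' v hv).mono fun w hw => he _ hw

end HasLaurentExpansion

end SpectralCurve

end BergmanPolynomials

/-! ### The structure of the multidifferentials -/

section Multidifferentials

variable {S : Type*} [TopologicalSpace S] [ChartedSpace ℂ S]

namespace SpectralCurve

variable {C : SpectralCurve S}

/-- The moving point `p w` stands for `z` or `z̄`. Once `ω_{0,1}` is excluded, the only unstable
case is `ω_{0,2}`, which is covered by `hB`. -/
theorem hasLaurentExpansion_multidiff_left {β : Fin C.N} {g n : ℕ} (h0 : ¬(g = 0 ∧ n = 0))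
    (hst : 1 < 2 * g + n → IsBergmanPoly C fun u : Fin (n + 1) → TangentBundle 𝓘(ℂ) S =>
      C.multidiff g n (u 0) fun i => u i.succ)
    {p : ℂ → TangentBundle 𝓘(ℂ) S}
    (hp : ∀ β' k, MeromorphicAt (fun w => C.bergmanCoeff β' k (p w)) (C.center β))
    (hp' : ∀ᶠ w in 𝓝[≠] C.center β, C.IsNoncritical (p w))
    (hB : C.HasExpansion β fun w (v : Fin 1 → TangentBundle 𝓘(ℂ) S) => C.bergman (p w) (v 0)) :
    C.HasLaurentExpansion β fun w (v : Fin n → TangentBundle 𝓘(ℂ) S) =>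
      C.multidiff g n (p w) v := by
  by_cases h : 1 < 2 * g + n
  · refine HasLaurentExpansion.subst (hst h) (fun w v => Fin.cons (p w) v) (fun β' k i => ?_)
      fun v hv => ?_
    · refine Fin.cases ?_ (fun i => ?_) i
      · exact .of_meromorphicAt (hp β' k)
      · exact .of_isBergmanPoly (.coeff β' k i)
    · filter_upwards [hp'] with w hw i
      refine Fin.cases hw (fun i => hv i) i
  · obtain ⟨rfl, rfl⟩ : g = 0 ∧ n = 1 := by omega
    simp only [multidiff_zero_one]
    exact hB.hasLaurentExpansion

theorem hasLaurentExpansion_multidiff_vec_conjVec [T2Space S] [IsManifold 𝓘(ℂ) ω S]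
    {β : Fin C.N} {g n : ℕ}
    (hst : 1 < 2 * g + (n + 1) →
      IsBergmanPoly C fun u : Fin (n + 1 + 1) → TangentBundle 𝓘(ℂ) S =>
        C.multidiff g (n + 1) (u 0) fun i => u i.succ) :
    C.HasLaurentExpansion β fun w (v : Fin n → TangentBundle 𝓘(ℂ) S) =>
      C.multidiff g (n + 1) (C.vec β w) (Fin.cons (C.conjVec β w) v) := by
  by_cases h : 1 < 2 * g + (n + 1)
  · refine HasLaurentExpansion.subst (hst h)
      (fun w v => Fin.cons (C.vec β w) (Fin.cons (C.conjVec β w) v)) (fun β' k i => ?_)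
      fun v hv => ?_
    · refine Fin.cases ?_ (fun i => Fin.cases ?_ (fun i => ?_) i) i
      · exact .of_meromorphicAt (C.meromorphicAt_bergmanCoeff_vec β' β k)
      · exact .of_meromorphicAt (C.meromorphicAt_bergmanCoeff_conjVec β' β k)
      · exact .of_isBergmanPoly (.coeff β' k i)
    · filter_upwards [C.eventually_isNoncritical_vec β,
        C.eventually_isNoncritical_conjVec β] with w hw hw' i
      exact Fin.cases hw (fun i => Fin.cases hw' (fun i => hv i) i) i
  · obtain ⟨rfl, rfl⟩ : g = 0 ∧ n = 0 := by omega
    exact HasLaurentExpansion.congr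
      (.of_meromorphicAt (C.meromorphicAt_bergman_vec_conjVec β))
      fun v _ => Eventually.of_forall fun w => (C.multidiff_zero_one (C.vec β w)
        (Fin.cons (α := fun _ : Fin 1 => TangentBundle 𝓘(ℂ) S) (C.conjVec β w) v)).symm

/-- Every factor in the bracket has smaller `2g' + n'`, because a factor with the full value would
be paired with the omitted `ω_{0,1}`. Polynomiality is a hypothesis so that the lemma can serve
inside the induction that proves it. -/
theorem hasLaurentExpansion_bracket_of [T2Space S] [IsManifold 𝓘(ℂ) ω S] {g n : ℕ}
    (hst : ∀ g' n', 2 * g' + n' < 2 * g + n → 1 < 2 * g' + n' →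
      IsBergmanPoly C fun u : Fin (n' + 1) → TangentBundle 𝓘(ℂ) S =>
        C.multidiff g' n' (u 0) fun i => u i.succ) (β : Fin C.N) :
    C.HasLaurentExpansion β fun w (v : Fin n → TangentBundle 𝓘(ℂ) S) =>
      C.bracket β g n w v := by
  unfold bracket
  have hzero : C.HasLaurentExpansion β fun _ (_ : Fin n → TangentBundle 𝓘(ℂ) S) => (0 : ℂ) :=
    .of_isBergmanPoly (.const 0)
  refine HasLaurentExpansion.add ?_ (.sum fun g₁ _ => .sum fun I _ => ?_)
  · split_ifs with hg
    · exact hzero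
    · exact hasLaurentExpansion_multidiff_vec_conjVec (hst _ _ (by omega))
  · split_ifs with hI
    · exact hzero
    · have h₁ := g₁.isLt
      have h₂ : I.card + Iᶜ.card = n := by simp
      have e₁ : C.HasLaurentExpansion β fun w (v : Fin I.card → TangentBundle 𝓘(ℂ) S) =>
          C.multidiff g₁ I.card (C.vec β w) v :=
        hasLaurentExpansion_multidiff_left (by tauto) (hst _ _ (by omega))
          (fun β' k => C.meromorphicAt_bergmanCoeff_vec β' β k)
          (C.eventually_isNoncritical_vec β) (HasExpansion.bergman_vec 0)
      have e₂ : C.HasLaurentExpansion β fun w (v : Fin Iᶜ.card → TangentBundle 𝓘(ℂ) S) =>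
          C.multidiff (g - g₁) Iᶜ.card (C.conjVec β w) v :=
        hasLaurentExpansion_multidiff_left (by tauto) (hst _ _ (by omega))
          (fun β' k => C.meromorphicAt_bergmanCoeff_conjVec β' β k)
          (C.eventually_isNoncritical_conjVec β) (HasExpansion.bergman_conjVec 0)
      exact (e₁.reindex (I.orderEmbOfFin rfl)).mul (e₂.reindex (Iᶜ.orderEmbOfFin rfl))

theorem meromorphicAt_kernel_denominator [IsManifold 𝓘(ℂ) ω S] (β : Fin C.N) :
    MeromorphicAt (fun w => 2 * (C.y (C.vec β w).proj - C.y (C.conjVec β w).proj) *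
      C.dxAt (C.vec β w)) (C.center β) :=
  ((analyticAt_const.mul ((C.analyticAt_y β).sub
    (AnalyticAt.comp_conj (C.analyticAt_y β)))).mul (C.analyticAt_dxAt β)).meromorphicAt

/-- Strong induction on `2g + n`: the kernel carries the dependence on `u 0` through the Bergman
integral, the bracket carries the rest, and the residue of their product is again a polynomial. -/
theorem isBergmanPoly_multidiff [T2Space S] [IsManifold 𝓘(ℂ) ω S] (g n : ℕ)
    (h : 1 < 2 * g + n) :
    IsBergmanPoly C fun u : Fin (n + 1) → TangentBundle 𝓘(ℂ) S =>
      C.multidiff g n (u 0) fun i => u i.succ := by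
  induction hN : 2 * g + n using Nat.strong_induction_on generalizing g n with
  | _ N ih =>
    simp only [C.multidiff_stable h]
    refine .sum fun β _ => HasLaurentExpansion.residue ?_
    have hb := hasLaurentExpansion_bracket_of
      (fun g' n' h1 h2 => ih _ (hN ▸ h1) g' n' h2 rfl) β
    have hk : C.HasLaurentExpansion β fun w (u : Fin (n + 1) → TangentBundle 𝓘(ℂ) S) =>
        C.kernel β (u 0) w :=
      ((HasExpansion.bergmanIntegral 0).hasLaurentExpansion.mul
        (.of_meromorphicAt (meromorphicAt_kernel_denominator β).inv)).congr
        fun v _ => Eventually.of_forall fun w => rfl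
    exact hk.mul (hb.reindex Fin.succ)

theorem meromorphicAt_bracket [T2Space S] [IsManifold 𝓘(ℂ) ω S] {g n : ℕ} (β : Fin C.N) {v : Fin n → TangentBundle 𝓘(ℂ) S}
    (hv : ∀ i, C.IsNoncritical (v i)) :
    MeromorphicAt (fun w => C.bracket β g n w v) (C.center β) :=
  (hasLaurentExpansion_bracket_of (fun g' n' _ h' => isBergmanPoly_multidiff g' n' h')
    β).meromorphicAt hv

theorem meromorphicAt_multidiff_vec [T2Space S] [IsManifold 𝓘(ℂ) ω S] {g n : ℕ}
    (h : 1 < 2 * g + n) (β : Fin C.N) {v : Fin n → TangentBundle 𝓘(ℂ) S}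
    (hv : ∀ i, C.IsNoncritical (v i)) :
    MeromorphicAt (fun w => C.multidiff g n (C.vec β w) v) (C.center β) :=
  (hasLaurentExpansion_multidiff_left (by omega) (isBergmanPoly_multidiff g n)
    (fun β' k => C.meromorphicAt_bergmanCoeff_vec β' β k) (C.eventually_isNoncritical_vec β)
    (HasExpansion.bergman_vec 0)).meromorphicAt hv

end SpectralCurve

end Multidifferentials

/-! ### The local Virasoro constraints -/

/-- Constants cancel in `φ - φ ∘ σ`, and terms of high order kill the pole of `G`. The coefficients
`ℓ` do not depend on `φ`, so the same functional can be applied both to primitives of `B` and to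
`x^(m+1) y`. -/
theorem exists_residue_mul_sub_comp_eq_sum {G σ : ℂ → ℂ} {c : ℂ} (hG : MeromorphicAt G c)
    (hσ : AnalyticAt ℂ σ c) (hσc : σ c = c) :
    ∃ (K : ℕ) (ℓ : ℕ → ℂ), ∀ φ : ℂ → ℂ, AnalyticAt ℂ φ c →
      HasResidue (fun w => G w * (φ w - φ (σ w))) c
        (∑ k ∈ Finset.range K, ℓ k * taylorCoeff φ c (k + 1)) := by
  obtain ⟨P, hP⟩ := id hG
  obtain ⟨q, hq, hσq⟩ := exists_taylor_remainder hσ 1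
  have hσq' : ∀ w, σ w - c = (w - c) * q w := fun w => by
    rw [hσq w]; simp [taylorCoeff, hσc]
  have hm : ∀ k : ℕ, MeromorphicAt (fun w => G w * ((w - c) ^ (k + 1) - (σ w - c) ^ (k + 1))) c :=
    fun k => hG.mul (AnalyticAt.meromorphicAt (by fun_prop))
  refine ⟨P, fun k => residue (fun w => G w * ((w - c) ^ (k + 1) - (σ w - c) ^ (k + 1))) c,
    fun φ hφ => ?_⟩
  obtain ⟨ψ, hψ, he⟩ := exists_taylor_remainder hφ (P + 1)
  have hψσ : AnalyticAt ℂ (fun w => ψ (σ w)) c := by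
    have : AnalyticAt ℂ ψ (σ c) := by rwa [hσc]
    exact this.comp (f := σ) hσ
  have hrem : AnalyticAt ℂ (fun w => (w - c) * ((w - c) ^ P • G w) *
      (ψ w - q w ^ (P + 1) * ψ (σ w))) c :=
    (AnalyticAt.mul (by fun_prop) hP).mul (hψ.sub ((hq.pow _).mul hψσ))
  have h := (HasResidue.sum (s := Finset.range P) fun k _ =>
    (hasResidue_of_meromorphicAt (hm k)).const_mul (taylorCoeff φ c (k + 1))).add
    (HasResidue.of_analyticAt hrem)
  rw [add_zero] at h
  simp only [mul_comm _ (taylorCoeff _ _ _)]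
  refine h.congr (Eventually.of_forall fun w => ?_)
  simp only [smul_eq_mul]
  -- Splitting off the constant term leaves the coefficients with index `k + 1`, the ones that match
  -- those of `B` under integration.
  rw [he w, he (σ w), Finset.sum_range_succ', Finset.sum_range_succ']
  have h1 : ∑ k ∈ Finset.range P, taylorCoeff φ c (k + 1) *
      (G w * ((w - c) ^ (k + 1) - (σ w - c) ^ (k + 1))) =
      G w * (∑ k ∈ Finset.range P, taylorCoeff φ c (k + 1) * (w - c) ^ (k + 1) -
        ∑ k ∈ Finset.range P, taylorCoeff φ c (k + 1) * (σ w - c) ^ (k + 1)) := by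
    rw [← Finset.sum_sub_distrib, Finset.mul_sum]
    exact Finset.sum_congr rfl fun k _ => by ring
  have h2 : (σ w - c) ^ (P + 1) = (w - c) ^ (P + 1) * q w ^ (P + 1) := by
    rw [hσq' w, mul_pow]
  rw [h1, h2]
  ring

section Virasoro

variable {S : Type*} [TopologicalSpace S] [ChartedSpace ℂ S]

namespace SpectralCurve

variable {C : SpectralCurve S}

/-- Only the principal part `(k + 1) / (w - c)^(k+2)` contributes, with `c` the centre, and it is
present only when the two critical points coincide. -/
theorem hasResidue_mul_bergmanCoeff_vec {β γ : Fin C.N} {f : ℂ → ℂ}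
    (hf : AnalyticAt ℂ f (C.center γ)) (k : ℕ) :
    HasResidue (fun w => f w * C.bergmanCoeff β k (C.vec γ w)) (C.center γ)
      (if β = γ then (k + 1) * taylorCoeff f (C.center γ) (k + 1) else 0) := by
  split_ifs with h
  · subst h
    obtain ⟨H, hH, he⟩ := C.bergmanCoeff_vec_self β k
    have h1 := ((HasResidue.taylor hf (k + 1)).const_mul ((k : ℂ) + 1)).add
      (HasResidue.of_analyticAt (hf.mul hH))
    rw [add_zero] at h1
    refine h1.congr ?_
    filter_upwards [he] with w hw
    rw [hw, Pi.mul_apply]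
    ring
  · obtain ⟨H, hH, he⟩ := C.bergmanCoeff_vec_of_ne (Ne.symm h) k
    refine (HasResidue.of_analyticAt (hf.mul hH)).congr ?_
    filter_upwards [he.filter_mono nhdsWithin_le_nhds] with w hw
    rw [hw, Pi.mul_apply]

theorem meromorphicAt_rhsIntegrand [T2Space S] [IsManifold 𝓘(ℂ) ω S] (γ : Fin C.N) (m : ℤ)
    {g n : ℕ} {v : Fin n → TangentBundle 𝓘(ℂ) S} (hv : ∀ i, C.IsNoncritical (v i)) :
    MeromorphicAt (C.rhsIntegrand γ m g n v) (C.center γ) :=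
  (((C.analyticAt_x γ).meromorphicAt.zpow (m + 1)).div (C.analyticAt_dxAt γ).meromorphicAt).mul
    (meromorphicAt_bracket γ hv)

theorem meromorphicAt_lhsIntegrand [T2Space S] [IsManifold 𝓘(ℂ) ω S] (γ : Fin C.N) (m : ℤ)
    {g n : ℕ} (h : 1 < 2 * g + n) {v : Fin n → TangentBundle 𝓘(ℂ) S}
    (hv : ∀ i, C.IsNoncritical (v i)) :
    MeromorphicAt (C.lhsIntegrand γ m g n v) (C.center γ) :=
  (((C.analyticAt_x γ).meromorphicAt.zpow (m + 1)).mul (C.analyticAt_y γ).meromorphicAt).mul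
    (meromorphicAt_multidiff_vec h γ hv)

theorem residue_lhsIntegrand [T2Space S] [IsManifold 𝓘(ℂ) ω S] (γ : Fin C.N) {m : ℤ}
    (hm : -1 ≤ m) {g n : ℕ} (h : 1 < 2 * g + n) {v : Fin n → TangentBundle 𝓘(ℂ) S}
    (hv : ∀ i, C.IsNoncritical (v i)) :
    residue (C.lhsIntegrand γ m g n v) (C.center γ) =
      1 / 2 * residue (C.rhsIntegrand γ m g n v) (C.center γ) := by
  -- The part of the recursion integrand that does not involve `z₀`.
  let G : Fin C.N → ℂ → ℂ := fun β w => C.bracket β g n w v /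
    (2 * (C.y (C.vec β w).proj - C.y (C.conjVec β w).proj) * C.dxAt (C.vec β w))
  have hG : ∀ β, MeromorphicAt (G β) (C.center β) := fun β =>
    (meromorphicAt_bracket β hv).div (meromorphicAt_kernel_denominator β)
  choose K ℓ hℓ using fun β =>
    exists_residue_mul_sub_comp_eq_sum (hG β) (C.analyticAt_conj β) (C.conj_center β)
  have hmulti : ∀ u, C.IsNoncritical u → C.multidiff g n u v =
      ∑ β, ∑ k ∈ Finset.range (K β), ℓ β k / (k + 1) * C.bergmanCoeff β k u := by
    intro u hu
    rw [C.multidiff_stable h]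
    refine Finset.sum_congr rfl fun β _ => ?_
    obtain ⟨F, hF, -, hF', hI⟩ := hu.exists_bergmanIntegral_eq β
    have h1 : residue (fun w => C.kernel β u w * C.bracket β g n w v) (C.center β) =
        ∑ k ∈ Finset.range (K β), ℓ β k * taylorCoeff F (C.center β) (k + 1) := by
      refine ((hℓ β F hF).congr ?_).residue_eq
      filter_upwards [hI.filter_mono nhdsWithin_le_nhds] with w hw
      simp only [kernel, hw, G]
      ring
    rw [h1]
    refine Finset.sum_congr rfl fun k _ => ?_
    rw [hF' k]
    ring
  -- Here `m ≥ -1` is essential: it makes `f` holomorphic at `z^γ` even if `x` vanishes there.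
  obtain ⟨N, hN⟩ : ∃ N : ℕ, m + 1 = N := ⟨(m + 1).toNat, by omega⟩
  let f : ℂ → ℂ := fun w => C.x (C.vec γ w).proj ^ (m + 1) * C.y (C.vec γ w).proj
  have hf : AnalyticAt ℂ f (C.center γ) := by
    simp only [f, hN, zpow_natCast]
    exact ((C.analyticAt_x γ).pow N).mul (C.analyticAt_y γ)
  have hl : HasResidue (C.lhsIntegrand γ m g n v) (C.center γ)
      (∑ β, ∑ k ∈ Finset.range (K β), ℓ β k / (k + 1) *
        (if β = γ then (k + 1) * taylorCoeff f (C.center γ) (k + 1) else 0)) := by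
    have h1 : HasResidue (fun w => ∑ β, ∑ k ∈ Finset.range (K β), ℓ β k / (k + 1) *
        (f w * C.bergmanCoeff β k (C.vec γ w))) (C.center γ)
        (∑ β, ∑ k ∈ Finset.range (K β), ℓ β k / (k + 1) *
        (if β = γ then (k + 1) * taylorCoeff f (C.center γ) (k + 1) else 0)) :=
      HasResidue.sum fun β _ => HasResidue.sum fun k _ =>
        (hasResidue_mul_bergmanCoeff_vec hf k).const_mul _
    refine h1.congr ?_
    filter_upwards [C.eventually_isNoncritical_vec γ] with w hw
    simp only [lhsIntegrand, hmulti _ hw, Finset.mul_sum]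
    refine Finset.sum_congr rfl fun β _ => Finset.sum_congr rfl fun k _ => ?_
    simp only [f]
    ring
  have hsum : (∑ β, ∑ k ∈ Finset.range (K β), ℓ β k / (k + 1) *
        (if β = γ then (k + 1) * taylorCoeff f (C.center γ) (k + 1) else 0)) =
      ∑ k ∈ Finset.range (K γ), ℓ γ k * taylorCoeff f (C.center γ) (k + 1) := by
    rw [Finset.sum_eq_single γ]
    · refine Finset.sum_congr rfl fun k _ => ?_
      rw [if_pos rfl]
      have : (k : ℂ) + 1 ≠ 0 := by exact_mod_cast k.succ_ne_zero
      field_simp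
    · intro β _ hβ
      simp [hβ]
    · simp
  have hr : HasResidue (fun w => 1 / 2 * C.rhsIntegrand γ m g n v w) (C.center γ)
      (∑ k ∈ Finset.range (K γ), ℓ γ k * taylorCoeff f (C.center γ) (k + 1)) := by
    -- The same functional `ℓ γ` is now read backwards, with `f` in place of the primitive.
    refine (hℓ γ f hf).congr ?_
    filter_upwards [C.y_sub_y_conjVec_ne_zero γ,
      (C.x_conjVec γ).filter_mono nhdsWithin_le_nhds] with w h1 h2
    have h3 : f w - f (C.conj γ w) = C.x (C.vec γ w).proj ^ (m + 1) *
        (C.y (C.vec γ w).proj - C.y (C.conjVec γ w).proj) := by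
      have h4 : f (C.conj γ w) = C.x (C.conjVec γ w).proj ^ (m + 1) * C.y (C.conjVec γ w).proj :=
        rfl
      rw [h4, h2, mul_sub]
    simp only [G, rhsIntegrand]
    rw [h3]
    -- If `dx` vanishes at `w`, both sides are `0` by the convention for division by zero, so
    -- isolation of the zeros of `dx` is not needed.
    by_cases hd : C.dxAt (C.vec γ w) = 0
    · simp [hd]
    · field_simp
  rw [hl.residue_eq, hsum, ← hr.residue_eq]
  exact ((hasResidue_of_meromorphicAt (meromorphicAt_rhsIntegrand γ m hv)).const_mul
    (1 / 2)).residue_eq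

end SpectralCurve

end Virasoro

end

end TR

theorem mainTheorem5 {S : Type*} [TopologicalSpace S] [T2Space S] [ConnectedSpace S]
    [ChartedSpace ℂ S] [IsManifold 𝓘(ℂ) ω S] (C : TR.SpectralCurve S)
    (g n : ℕ) (hgn : 0 < 2 * (g : ℤ) - 2 + (n : ℤ) + 1) (m : ℤ) (hm : -1 ≤ m)
    (v : Fin n → TangentBundle 𝓘(ℂ) S) (hv : ∀ i γ, (v i).proj ≠ C.crit γ) :
    (∀ γ : Fin C.N,
      MeromorphicAt (C.lhsIntegrand γ m g n v) (C.center γ) ∧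
      MeromorphicAt (C.rhsIntegrand γ m g n v) (C.center γ) ∧
      TR.residue (C.lhsIntegrand γ m g n v) (C.center γ) =
        1 / 2 * TR.residue (C.rhsIntegrand γ m g n v) (C.center γ)) ∧
    ∑ γ, TR.residue (C.lhsIntegrand γ m g n v) (C.center γ) =
      1 / 2 * ∑ γ, TR.residue (C.rhsIntegrand γ m g n v) (C.center γ) := by
  have h : 1 < 2 * g + n := by omega
  have hres := fun γ => TR.SpectralCurve.residue_lhsIntegrand (C := C) γ hm h hv
  refine ⟨fun γ => ⟨TR.SpectralCurve.meromorphicAt_lhsIntegrand γ m h hv,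
    TR.SpectralCurve.meromorphicAt_rhsIntegrand γ m hv, hres γ⟩, ?_⟩
  rw [Finset.mul_sum]
  exact Finset.sum_congr rfl fun γ _ => hres γ
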